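/- Conventions. Let $n\ge 1$, let $\mathrm{B}_n$ be the Artin braid group with generators $\sigma_1,\dots,\sigma_{n-1}$, and for a commutative ring $R$ and a unit $t\in R^\times$ let $\mathrm{Burau}_t:\mathrm{B}_n\to \mathrm{GL}_n(R)$ be the unreduced Burau representation, given by $$\mathrm{Burau}_t(\sigma_i)=\mathrm{Id}_{i-1}\oplus\begin{pmatrix}1-t&t\\1&0\end{pmatrix}\oplus \mathrm{Id}_{n-i-1}.$$ For an $n\times n$ matrix $M$, let $M_0$ be the $(n-1)\times(n-1)$ matrix obtained by removing the first row and the first column. Let $L$ be an oriented link given by a diagram, and let $\Gamma_L$ be its link group, given by the Wirtinger presentation of the diagram: one generator for each arc, and for each crossing with overpassing arc $x$, incoming underpassing arc $y$ and outgoing underpassing arc $z$ the relation $z=xyx^{-1}$ (positive crossing) or $z=x^{-1}yx$ (negative crossing). Let $\chi:\Gamma_L\to\langle t\rangle\cong\mathbb Z$ send every Wirtinger generator (meridian) to $t$. For a finite presentation $\Gamma_L=\langle x_1,\dots,x_N\mid r_1,\dots,r_s\rangle$, the Alexander matrix is the $s\times N$ matrix over $\mathbb Z[t,t^{-1}]$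 whose entries are the images under $\chi$ of the Fox derivatives $\partial r_i/\partial x_j$, and the first elementary ideal is generated by its $(N-1)\times(N-1)$ minors. A (one-variable) Alexander polynomial $\Delta_L(t)\in\mathbb Z[t,t^{-1}]$ of $L$ is a greatest common divisor of the elements of this ideal, for every finite presentation of $\Gamma_L$; it is determined up to units $\pm t^k$. Statement. Let $B\in \mathrm{B}_n$ be a braid and let $\overline B$ be the oriented link obtained by closing the braid diagram of any word that represents $B$. Then $\det\big((\mathrm{Id}-\mathrm{Burau}_t(B))_0\big)\in\mathbb Z[t,t^{-1}]$ is an Alexander polynomial of $\overline B$. In particular, for every Alexander polynomial $\Delta_{\overline B}$ of $\overline B$ there are a sign $\pm$ and $k\in\mathbb Z$ such that $$\Delta_{\overline B}(t)=\pm t^k\det\big((\mathrm{Id}-\mathrm{Burau}_t(B))_0\big)\qquad\text{for all } t\in\mathbb C^*,$$ where $\mathrm{Burau}_t(B)\in\mathrm{GL}_n(\mathbb C)$ is the Burau matrix at the complex number $t$. -/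

import Mathlib

open scoped LaurentPolynomial

noncomputable section

/-! ## Fox calculus and the Alexander polynomial of a group over the integers -/

section Fox

variable {α : Type} [DecidableEq α]

/-- The Fox derivative with respect to the generator `i`, computed letter by letter on a word
(the letter `(x, true)` is `x`, the letter `(x, false)` is `x⁻¹`). -/
def foxWord (i : α) : List (α × Bool) → MonoidAlgebra ℤ (FreeGroup α)
  | [] => 0
  | (x, true) :: w =>
      (if x = i then 1 else 0) + MonoidAlgebra.of ℤ _ (FreeGroup.of x) * foxWord i w
  | (x, false) :: w =>
      MonoidAlgebra.of ℤ _ (FreeGroup.of x)⁻¹ * (foxWord i w - if x = i then 1 else 0)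

theorem foxWord_append (i : α) (u v : List (α × Bool)) :
    foxWord i (u ++ v) = foxWord i u + MonoidAlgebra.of ℤ _ (FreeGroup.mk u) * foxWord i v := by
  induction u with
  | nil => rw [← FreeGroup.one_eq_mk, map_one, one_mul, foxWord, zero_add, List.nil_append]
  | cons p u ih =>
    obtain ⟨x, b⟩ := p
    have hc : ∀ b, FreeGroup.mk ((x, b) :: u) = FreeGroup.mk [(x, b)] * FreeGroup.mk u := by
      intro b; simp [FreeGroup.mul_mk]
    cases b
    · have h1 : FreeGroup.mk [(x, false)] = (FreeGroup.of x)⁻¹ := by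
        simp [FreeGroup.of, FreeGroup.inv_mk, FreeGroup.invRev]
      rw [hc, h1, map_mul, List.cons_append, foxWord, ih, foxWord]
      noncomm_ring
    · have h1 : FreeGroup.mk [(x, true)] = FreeGroup.of x := rfl
      rw [hc, h1, map_mul, List.cons_append, foxWord, ih, foxWord]
      noncomm_ring

theorem foxWord_step (i : α) {u v : List (α × Bool)} (h : FreeGroup.Red.Step u v) :
    foxWord i u = foxWord i v := by
  obtain @⟨L₁, L₂, x, b⟩ := h
  rw [foxWord_append, foxWord_append]
  congr 2
  cases b
  · simp only [foxWord, Bool.not_false]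
    rw [add_sub_cancel_left, ← mul_assoc, ← map_mul, inv_mul_cancel, map_one, one_mul]
  · simp only [foxWord, Bool.not_true]
    rw [← mul_assoc, ← map_mul, mul_inv_cancel, map_one, one_mul, add_sub_cancel]

/-- The Fox derivative `∂w/∂xᵢ` of an element `w` of the free group. -/
def foxDeriv (i : α) (w : FreeGroup α) : MonoidAlgebra ℤ (FreeGroup α) :=
  Quot.lift (foxWord i) (fun _ _ h => foxWord_step i h) w

theorem foxDeriv_one (i : α) : foxDeriv i (1 : FreeGroup α) = 0 := rfl

theorem foxDeriv_of (i j : α) : foxDeriv i (FreeGroup.of j) = if j = i then 1 else 0 := by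
  change foxWord i [(j, true)] = _
  simp [foxWord]

theorem foxDeriv_mul (i : α) (u v : FreeGroup α) :
    foxDeriv i (u * v) = foxDeriv i u + MonoidAlgebra.of ℤ _ u * foxDeriv i v := by
  induction u using Quot.inductionOn
  induction v using Quot.inductionOn
  exact foxWord_append i _ _

end Fox

/-- A finite presentation `⟨x₁, …, xₙ | r₁, …, rₛ⟩` of a group. -/
structure FinitePresentation (Γ : Type) [Group Γ] where
  numGens : ℕ
  numRels : ℕ
  rel : Fin numRels → FreeGroup (Fin numGens)
  iso : PresentedGroup (Set.range rel) ≃* Γ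

namespace FinitePresentation

variable {Γ : Type} [Group Γ]

/-- The ring homomorphism `w ↦ {w}` from `ℤ[Fₙ]` to `ℤ[t, t⁻¹]` obtained from the projection
`Fₙ → Γ` and a homomorphism `χ` from `Γ` to the infinite cyclic group generated by `t`. -/
def brace (P : FinitePresentation Γ) (χ : Γ →* Multiplicative ℤ) :
    MonoidAlgebra ℤ (FreeGroup (Fin P.numGens)) →ₐ[ℤ] ℤ[T;T⁻¹] :=
  MonoidAlgebra.lift ℤ ℤ[T;T⁻¹] (FreeGroup (Fin P.numGens))
    ((AddMonoidAlgebra.of ℤ ℤ).comp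
      (χ.comp (P.iso.toMonoidHom.comp (PresentedGroup.mk (Set.range P.rel)))))

/-- The Alexander matrix `({∂rᵢ/∂xⱼ})` of the presentation. -/
def alexanderMatrix (P : FinitePresentation Γ) (χ : Γ →* Multiplicative ℤ) :
    Matrix (Fin P.numRels) (Fin P.numGens) ℤ[T;T⁻¹] :=
  Matrix.of fun i j => P.brace χ (foxDeriv j (P.rel i))

/-- The first elementary ideal: generated by the `(n - 1) × (n - 1)` minors of the Alexander
matrix, `n` being the number of generators. (Selections `r`, `c` of rows and columns with a
repetition contribute `0`, and reordering a selection changes only the sign. For `n ≤ 1`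
the only minor is the empty one, equal to `1`.) -/
def firstElementaryIdeal (P : FinitePresentation Γ) (χ : Γ →* Multiplicative ℤ) :
    Ideal ℤ[T;T⁻¹] :=
  Ideal.span {d | ∃ (r : Fin (P.numGens - 1) → Fin P.numRels)
    (c : Fin (P.numGens - 1) → Fin P.numGens), d = ((P.alexanderMatrix χ).submatrix r c).det}

end FinitePresentation

/-- `Δ` is an Alexander polynomial of `(Γ, χ)`: the group `Γ` is finitely presented and, whichever
finite presentation is used, `Δ` is a greatest common divisor of the elements of the first
elementary ideal. It is determined up to the units `± tᵏ` of `ℤ[t, t⁻¹]`. -/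
def IsAlexanderPolynomialOf (Γ : Type) [Group Γ] (χ : Γ →* Multiplicative ℤ)
    (Δ : ℤ[T;T⁻¹]) : Prop :=
  Nonempty (FinitePresentation Γ) ∧ ∀ P : FinitePresentation Γ, ∀ d : ℤ[T;T⁻¹],
    d ∣ Δ ↔ ∀ x ∈ P.firstElementaryIdeal χ, d ∣ x

/-! ## Oriented tangle diagrams and link diagrams -/

/-- Orientation of a strand at a horizontal level: `pos` is upwards, `neg` is downwards. -/
inductive Strand
  | pos
  | neg

/-- Oriented tangle diagrams, drawn from bottom to top and cut into the elementary pieces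
`X₊, X₋ : (+,+) → (+,+)`, two caps, two cups, and vertical strands.
`comp T' T` is `T' ∘ T`, with `T'` placed on top of `T`; `tensor T T'` has `T'` to the right. -/
inductive TangleDiagram
  | id (ε : List Strand)
  | xPos
  | xNeg
  | capPosNeg
  | capNegPos
  | cupPosNeg
  | cupNegPos
  | comp (T' T : TangleDiagram)
  | tensor (T T' : TangleDiagram)

namespace TangleDiagram

open Strand

/-- The sequence of signs along the bottom of the diagram. -/
def source : TangleDiagram → List Strand
  | id ε => ε
  | xPos => [pos, pos]
  | xNeg => [pos, pos]
  | capPosNeg => [pos, neg]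
  | capNegPos => [neg, pos]
  | cupPosNeg => []
  | cupNegPos => []
  | comp _ T => T.source
  | tensor T T' => T.source ++ T'.source

/-- The sequence of signs along the top of the diagram. -/
def target : TangleDiagram → List Strand
  | id ε => ε
  | xPos => [pos, pos]
  | xNeg => [pos, pos]
  | capPosNeg => []
  | capNegPos => []
  | cupPosNeg => [pos, neg]
  | cupNegPos => [neg, pos]
  | comp T' _ => T'.target
  | tensor T T' => T.target ++ T'.target

/-- All the compositions in the diagram are between matching sequences of signs. -/
def WellFormed : TangleDiagram → Prop
  | comp T' T => T'.WellFormed ∧ T.WellFormed ∧ T.target = T'.source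
  | tensor T T' => T.WellFormed ∧ T'.WellFormed
  | _ => True

/-- The pieces of arcs of the diagram. A crossing has three: the overpassing arc and the incoming
and outgoing underpassing arcs. -/
inductive Arc : TangleDiagram → Type
  | strand (ε : List Strand) (i : Fin ε.length) : Arc (id ε)
  | posOver : Arc xPos
  | posUnderIn : Arc xPos
  | posUnderOut : Arc xPos
  | negOver : Arc xNeg
  | negUnderIn : Arc xNeg
  | negUnderOut : Arc xNeg
  | capPN : Arc capPosNeg
  | capNP : Arc capNegPos
  | cupPN : Arc cupPosNeg
  | cupNP : Arc cupNegPos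
  | upper {T' T : TangleDiagram} (a : Arc T') : Arc (comp T' T)
  | lower {T' T : TangleDiagram} (a : Arc T) : Arc (comp T' T)
  | left {T T' : TangleDiagram} (a : Arc T) : Arc (tensor T T')
  | right {T T' : TangleDiagram} (a : Arc T') : Arc (tensor T T')

open Arc

/-- The arcs met along the bottom of the diagram, from left to right. In `xPos` the overpassing
strand goes from bottom left to top right, in `xNeg` from bottom right to top left. -/
def bottomArcs : (T : TangleDiagram) → List T.Arc
  | id ε => (List.finRange ε.length).map (strand ε)
  | xPos => [posOver, posUnderIn]
  | xNeg => [negUnderIn, negOver]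
  | capPosNeg => [capPN, capPN]
  | capNegPos => [capNP, capNP]
  | cupPosNeg => []
  | cupNegPos => []
  | comp _ T => T.bottomArcs.map lower
  | tensor T T' => T.bottomArcs.map left ++ T'.bottomArcs.map right

/-- The arcs met along the top of the diagram, from left to right. -/
def topArcs : (T : TangleDiagram) → List T.Arc
  | id ε => (List.finRange ε.length).map (strand ε)
  | xPos => [posUnderOut, posOver]
  | xNeg => [negOver, negUnderOut]
  | capPosNeg => []
  | capNegPos => []
  | cupPosNeg => [cupPN, cupPN]
  | cupNegPos => [cupNP, cupNP]
  | comp T' _ => T'.topArcs.map upper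
  | tensor T T' => T.topArcs.map left ++ T'.topArcs.map right

open FreeGroup in
/-- The Wirtinger relators. With `x` the overpassing, `y` the incoming and `z` the outgoing
underpassing arc they express `z = x y x⁻¹` at a positive crossing and `z = x⁻¹ y x` at a negative
crossing. In `T' ∘ T`, where an arc `x` ending at the top of `T` is continued by an arc `y` at the
bottom of `T'`, there is the relation `x = y`. -/
def wirtingerRels : (T : TangleDiagram) → List (FreeGroup T.Arc)
  | xPos => [of posOver * of posUnderIn * (of posOver)⁻¹ * (of posUnderOut)⁻¹]
  | xNeg => [(of negOver)⁻¹ * of negUnderIn * of negOver * (of negUnderOut)⁻¹]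
  | comp T' T =>
      T'.wirtingerRels.map (FreeGroup.map upper) ++
      T.wirtingerRels.map (FreeGroup.map lower) ++
      List.zipWith (fun x y => of (lower x) * (of (upper y))⁻¹) T.topArcs T'.bottomArcs
  | tensor T T' =>
      T.wirtingerRels.map (FreeGroup.map left) ++
      T'.wirtingerRels.map (FreeGroup.map right)
  | _ => []

/-- The group of the diagram, given by its Wirtinger presentation: one generator for each arc
(the meridian of the arc, oriented by the right-hand rule) and one relator for each crossing. -/
abbrev WirtingerGroup (T : TangleDiagram) : Type :=
  PresentedGroup {r : FreeGroup T.Arc | r ∈ T.wirtingerRels}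

theorem lift_wirtingerRels {G : Type} [CommGroup G] (g : G) (T : TangleDiagram) :
    ∀ r ∈ T.wirtingerRels, FreeGroup.lift (fun _ : T.Arc => g) r = 1 := by
  have key : ∀ {A B : Type} (f : A → B) (s : FreeGroup A),
      FreeGroup.lift (fun _ : B => g) (FreeGroup.map f s) = FreeGroup.lift (fun _ : A => g) s := by
    intro A B f s
    rw [FreeGroup.map_eq_lift, ← MonoidHom.comp_apply]
    congr 1
    ext a
    simp
  induction T with
  | comp T' T ih' ih =>
    intro r hr
    simp only [wirtingerRels, List.mem_append, List.mem_map] at hr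
    rcases hr with (⟨s, hs, rfl⟩ | ⟨s, hs, rfl⟩) | hr
    · rw [key, ih' s hs]
    · rw [key, ih s hs]
    · obtain ⟨k, hk, rfl⟩ := List.mem_iff_getElem.mp hr
      simp
  | tensor T T' ih ih' =>
    intro r hr
    simp only [wirtingerRels, List.mem_append, List.mem_map] at hr
    rcases hr with ⟨s, hs, rfl⟩ | ⟨s, hs, rfl⟩
    · rw [key, ih s hs]
    · rw [key, ih' s hs]
  | _ => simp [wirtingerRels]

/-- The homomorphism to the infinite cyclic group `⟨t⟩` that sends every meridian to `t`. -/
def meridianHom (T : TangleDiagram) : T.WirtingerGroup →* Multiplicative ℤ :=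
  PresentedGroup.toGroup (f := fun _ => Multiplicative.ofAdd 1) (T.lift_wirtingerRels _)

end TangleDiagram

/-- An oriented link diagram: a tangle diagram without boundary points. -/
structure LinkDiagram where
  toTangle : TangleDiagram
  wellFormed : toTangle.WellFormed
  source_eq : toTangle.source = []
  target_eq : toTangle.target = []

/-- `Δ` is an Alexander polynomial of the oriented link with diagram `L`. -/
def LinkDiagram.IsAlexanderPolynomial (L : LinkDiagram) (Δ : ℤ[T;T⁻¹]) : Prop :=
  IsAlexanderPolynomialOf L.toTangle.WirtingerGroup L.toTangle.meridianHom Δ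

/-! ## Braids and their closures -/

/-- The relators of the Artin presentation on `σ₀, …, σₙ₋₂`. -/
def braidRels (n : ℕ) : Set (FreeGroup (Fin (n - 1))) :=
  {r | ∃ i j : Fin (n - 1), (i : ℕ) + 2 ≤ j ∧
      r = .of i * .of j * (.of j * .of i)⁻¹} ∪
  {r | ∃ i j : Fin (n - 1), (i : ℕ) + 1 = j ∧
      r = .of i * .of j * .of i * (.of j * .of i * .of j)⁻¹}

/-- The Artin braid group on `n` strands. -/
abbrev BraidGroup (n : ℕ) : Type := PresentedGroup (braidRels n)

/-- The braid represented by a word in the Artin generators: `(i, true)` stands for `σᵢ` and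
`(i, false)` for `σᵢ⁻¹`. -/
def braidOfWord (n : ℕ) (w : List (Fin (n - 1) × Bool)) : BraidGroup n :=
  PresentedGroup.mk (braidRels n) (FreeGroup.mk w)

namespace TangleDiagram

open Strand

/-- `id ⊗ X± ⊗ id` on `n` upward strands, with the crossing at the strands `i`, `i + 1`. -/
def ofLetter {n : ℕ} (p : Fin (n - 1) × Bool) : TangleDiagram :=
  tensor (tensor (id (List.replicate p.1 pos)) (if p.2 then xPos else xNeg))
    (id (List.replicate (n - 2 - p.1) pos))

/-- The braid diagram of a word; the first letter is at the top. -/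
def ofWord {n : ℕ} : List (Fin (n - 1) × Bool) → TangleDiagram
  | [] => id (List.replicate n pos)
  | p :: w => comp (ofLetter p) (ofWord w)

/-- The `n` nested caps `(+, …, +, -, …, -) → ∅`. -/
def ev : ℕ → TangleDiagram
  | 0 => id []
  | n + 1 => comp capPosNeg (tensor (tensor (id [pos]) (ev n)) (id [neg]))

/-- The `n` nested cups `∅ → (+, …, +, -, …, -)`. -/
def coev : ℕ → TangleDiagram
  | 0 => id []
  | n + 1 => comp (tensor (tensor (id [pos]) (coev n)) (id [neg])) cupPosNeg

theorem ofLetter_spec {n : ℕ} (p : Fin (n - 1) × Bool) : (ofLetter p).WellFormed ∧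
    (ofLetter p).source = List.replicate n pos ∧ (ofLetter p).target = List.replicate n pos := by
  obtain ⟨i, b⟩ := p
  have hi := i.isLt
  have h3 : List.replicate i pos ++ [pos, pos] ++ List.replicate (n - 2 - i) pos =
      List.replicate n pos := by
    rw [show ([pos, pos] : List Strand) = List.replicate 2 pos from rfl,
      List.replicate_append_replicate, List.replicate_append_replicate]
    congr 1
    omega
  cases b
  · exact ⟨⟨⟨trivial, trivial⟩, trivial⟩, h3, h3⟩
  · exact ⟨⟨⟨trivial, trivial⟩, trivial⟩, h3, h3⟩

theorem ofWord_spec {n : ℕ} (w : List (Fin (n - 1) × Bool)) : (ofWord w).WellFormed ∧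
    (ofWord w).source = List.replicate n pos ∧ (ofWord w).target = List.replicate n pos := by
  induction w with
  | nil => simp [ofWord, WellFormed, source, target]
  | cons p w ih =>
    obtain ⟨h1, h2, h3⟩ := ofLetter_spec p
    simp [ofWord, WellFormed, source, target, h1, h2, h3, ih]

theorem replicate_pos_neg (n : ℕ) :
    [pos] ++ (List.replicate n pos ++ List.replicate n neg) ++ [neg] =
      List.replicate (n + 1) pos ++ List.replicate (n + 1) neg := by
  rw [List.replicate_succ, List.replicate_succ' (a := neg)]
  simp

theorem ev_spec (n : ℕ) : (ev n).WellFormed ∧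
    (ev n).source = List.replicate n pos ++ List.replicate n neg ∧ (ev n).target = [] := by
  induction n with
  | zero => simp [ev, WellFormed, source, target]
  | succ n ih =>
    refine ⟨?_, ?_, rfl⟩
    · simp [ev, WellFormed, source, target, ih]
    · rw [← replicate_pos_neg]
      simp [ev, source, ih]

theorem coev_spec (n : ℕ) : (coev n).WellFormed ∧
    (coev n).source = [] ∧ (coev n).target = List.replicate n pos ++ List.replicate n neg := by
  induction n with
  | zero => simp [coev, WellFormed, source, target]
  | succ n ih =>
    refine ⟨?_, rfl, ?_⟩
    · simp [coev, WellFormed, source, target, ih]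
    · rw [← replicate_pos_neg]
      simp [coev, target, ih]

end TangleDiagram

open TangleDiagram in
/-- The closure `ev ∘ (B ⊗ id) ∘ coev` of the braid diagram of a word: each upper endpoint is
joined to the lower endpoint in the same position. -/
def braidClosure (n : ℕ) (w : List (Fin (n - 1) × Bool)) : LinkDiagram where
  toTangle := comp (ev n) (comp (tensor (ofWord w) (id (List.replicate n Strand.neg))) (coev n))
  wellFormed := by
    simp [WellFormed, source, target, ev_spec n, coev_spec n, ofWord_spec w]
  source_eq := (coev_spec n).2.1
  target_eq := (ev_spec n).2.2

/-! ## The Burau representation -/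

section Burau

variable {R : Type} [CommRing R]

/-- The action of `σᵢ` on `Rⁿ`: it is `(a, b) ↦ ((1 - t) a + t b, a)` on the coordinates `i`,
`i + 1` and the identity on the others. Its matrix has the block `(1 - t, t; 1, 0)`. -/
def burauGen {n : ℕ} (t : Rˣ) (i : Fin (n - 1)) : (Fin n → R) ≃ₗ[R] (Fin n → R) where
  toFun v k :=
    if (k : ℕ) = i then (1 - t) * v ⟨i, by omega⟩ + t * v ⟨i + 1, by omega⟩
    else if (k : ℕ) = i + 1 then v ⟨i, by omega⟩
    else v k
  invFun v k :=
    if (k : ℕ) = i then v ⟨i + 1, by omega⟩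
    else if (k : ℕ) = i + 1 then
      ((t⁻¹ : Rˣ) : R) * v ⟨i, by omega⟩ + (1 - ((t⁻¹ : Rˣ) : R)) * v ⟨i + 1, by omega⟩
    else v k
  map_add' v w := by
    ext k; simp only [Pi.add_apply]; split_ifs <;> ring
  map_smul' c v := by
    ext k; simp only [Pi.smul_apply, smul_eq_mul, RingHom.id_apply]; split_ifs <;> ring
  left_inv v := by
    have ht : ((t⁻¹ : Rˣ) : R) * t = 1 := t.inv_mul
    ext ⟨k, hk⟩
    by_cases h1 : k = i
    · subst h1; simp
    · by_cases h2 : k = i + 1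
      · subst h2
        simp only [↓reduceIte, Nat.succ_ne_self]
        linear_combination (v ⟨i + 1, hk⟩ - v ⟨i, by omega⟩) * ht
      · simp [h1, h2]
  right_inv v := by
    have ht : (t : R) * ((t⁻¹ : Rˣ) : R) = 1 := t.mul_inv
    ext ⟨k, hk⟩
    by_cases h1 : k = i
    · subst h1
      simp only [↓reduceIte, Nat.succ_ne_self]
      linear_combination (v ⟨i, hk⟩ - v ⟨i + 1, by omega⟩) * ht
    · by_cases h2 : k = i + 1
      · subst h2; simp
      · simp [h1, h2]

theorem burauGen_apply {n : ℕ} (t : Rˣ) (i : Fin (n - 1)) (v : Fin n → R) (k : Fin n) :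
    burauGen t i v k =
      if (k : ℕ) = i then (1 - (t : R)) * v ⟨i, by omega⟩ + t * v ⟨i + 1, by omega⟩
      else if (k : ℕ) = i + 1 then v ⟨i, by omega⟩
      else v k := rfl

theorem burauGen_comm {n : ℕ} (t : Rˣ) (i j : Fin (n - 1)) (h : (i : ℕ) + 2 ≤ j) :
    burauGen (R := R) t i * burauGen t j = burauGen t j * burauGen t i := by
  ext1 v
  funext k
  have e1 : ¬ (i : ℕ) = j := by omega
  have e2 : ¬ (i : ℕ) = j + 1 := by omega
  have e3 : ¬ (i : ℕ) + 1 = j := by omega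
  have e4 : ¬ (j : ℕ) = i := by omega
  have e5 : ¬ (j : ℕ) = i + 1 := by omega
  have e6 : ¬ (j : ℕ) + 1 = i := by omega
  simp only [LinearEquiv.mul_apply, burauGen_apply, Nat.add_right_cancel_iff, e1, e2, e3, e4, e5,
    e6, ↓reduceIte]
  split_ifs <;> first | rfl | omega

theorem burauGen_braid {n : ℕ} (t : Rˣ) (i j : Fin (n - 1)) (h : (i : ℕ) + 1 = j) :
    burauGen (R := R) t i * burauGen t j * burauGen t i =
      burauGen t j * burauGen t i * burauGen t j := by
  ext1 v
  funext k
  obtain ⟨j, hj⟩ := j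
  obtain ⟨i, hi⟩ := i
  obtain rfl : i + 1 = j := h
  have e1 : ¬ i = i + 1 + 1 := by omega
  have e2 : ¬ i + 1 + 1 = i := by omega
  simp only [LinearEquiv.mul_apply, burauGen_apply, e1, e2, Nat.succ_ne_self,
    Nat.left_eq_add, one_ne_zero, ↓reduceIte]
  split_ifs <;> first | rfl | omega | ring

/-- The (unreduced) Burau representation at `t`, acting on `Rⁿ`. -/
def burau {n : ℕ} (t : Rˣ) : BraidGroup n →* ((Fin n → R) ≃ₗ[R] (Fin n → R)) :=
  PresentedGroup.toGroup (f := burauGen t) (by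
    rintro r (⟨i, j, h, rfl⟩ | ⟨i, j, h, rfl⟩)
    · simp only [map_mul, map_inv, FreeGroup.lift_apply_of]
      rw [mul_inv_eq_one, burauGen_comm t i j h]
    · simp only [map_mul, map_inv, FreeGroup.lift_apply_of]
      rw [mul_inv_eq_one, burauGen_braid t i j h])

/-- The matrix of the Burau representation in the standard basis. -/
def burauMatrix {n : ℕ} (t : Rˣ) (B : BraidGroup n) : Matrix (Fin n) (Fin n) R :=
  LinearMap.toMatrix' (burau t B : (Fin n → R) →ₗ[R] (Fin n → R))

end Burau

/-- The matrix with its first row and its first column removed. -/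
def Matrix.removeFirst {R : Type} {m : ℕ} (M : Matrix (Fin (m + 1)) (Fin (m + 1)) R) :
    Matrix (Fin m) (Fin m) R :=
  M.submatrix Fin.succ Fin.succ

/-- The indeterminate `t` as a unit of `ℤ[t, t⁻¹]`. -/
def laurentT : ℤ[T;T⁻¹]ˣ where
  val := LaurentPolynomial.T 1
  inv := LaurentPolynomial.T (-1)
  val_inv := by rw [← LaurentPolynomial.T_add]; simp
  inv_val := by rw [← LaurentPolynomial.T_add]; simp

/-- The value `Δ(t)` at a nonzero complex number `t`. -/
def evalComplex (t : ℂˣ) (Δ : ℤ[T;T⁻¹]) : ℂ :=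
  LaurentPolynomial.eval₂ (Int.castRingHom ℂ) t Δ

end

noncomputable section

/-! ## Ideals of minors -/

section Minors

variable {R : Type*} [CommRing R]

/-! Write Λ = ℤ[t, t⁻¹]. The Alexander module of (Γ, χ) is the Λ-module receiving the universal
crossed homomorphism δ on Γ, where g acts through χ(g). For every finite presentation, the rows of
the Alexander matrix span the linear relations between the values of δ at the generators
(`relationsOn_eq_span`). Up to a shift in size, ideals of minors of relations depend only on the
module and not on the generating family (`minorIdeal_relationsOn_eq`). Hence the first elementary
ideal may be computed from any convenient generators of the Alexander module.

For a Wirtinger group, a crossed homomorphism to X amounts to a coloring of the arcs by elements of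
X that satisfies the Fox-linearized relation at each crossing. In a braid diagram these relations
carry the colors at the bottom to the top by the Burau matrix, and closing the braid forces top and
bottom to agree. Colorings of the closure are therefore the vectors of Xⁿ fixed by the Burau matrix.
So the Alexander module is the quotient of Λⁿ by the rows of M = Id - Burau, and the ideal is
generated by the (n-1)-minors of M (`firstElementaryIdeal_closedBraid`).

Finally M kills the constant column, and the row (1, t, …, tⁿ⁻¹) kills M from the left. This makes
every such minor a multiple of det M₀ (`Matrix.minorIdeal_eq_span_removeFirst`), so the ideal is
principal and det M₀ is a gcd of its elements. Any other gcd differs by a unit ±tᵏ of Λ, and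
evaluation at a complex number commutes with forming Burau matrices and determinants. -/

theorem MultilinearMap.map_mem_of_forall_mem_span {κ M N : Type*} [Finite κ]
    [AddCommGroup M] [Module R M] [AddCommGroup N] [Module R N]
    (f : MultilinearMap R (fun _ : κ => M) N) (S : Set M) (J : Submodule R N)
    (h : ∀ v : κ → M, (∀ i, v i ∈ S) → f v ∈ J) (v : κ → M)
    (hv : ∀ i, v i ∈ Submodule.span R S) : f v ∈ J := by
  classical
  have := Fintype.ofFinite κ
  -- Induction on the set `s` of slots allowed to range over the span; the remaining slots take
  -- values in `S` itself.
  have key : ∀ (s : Finset κ) (v : κ → M), (∀ i ∈ s, v i ∈ Submodule.span R S) →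
      (∀ i ∉ s, v i ∈ S) → f v ∈ J := by
    intro s
    induction s using Finset.induction_on with
    | empty => exact fun v _ h' => h v fun i => h' i (Finset.notMem_empty i)
    | insert a s ha ih =>
      intro v hv hv'
      have hx : ∀ x ∈ Submodule.span R S, f (Function.update v a x) ∈ J := by
        intro x hx
        induction hx using Submodule.span_induction with
        | mem x hx =>
          refine ih _ (fun i hi => ?_) (fun i hi => ?_)
          · rw [Function.update_of_ne (ne_of_mem_of_not_mem hi ha)]
            exact hv i (Finset.mem_insert_of_mem hi)
          · by_cases hia : i = a
            · subst hia; simpa using hx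
            · rw [Function.update_of_ne hia]
              exact hv' i (by simp [hia, hi])
        | zero => rw [f.map_update_zero]; exact J.zero_mem
        | add x y _ _ h1 h2 => rw [f.map_update_add]; exact J.add_mem h1 h2
        | smul c x _ h1 => rw [f.map_update_smul]; exact J.smul_mem c h1
      simpa using hx (v a) (hv a (Finset.mem_insert_self a s))
  exact key Finset.univ v (fun i _ => hv i) (fun i hi => absurd (Finset.mem_univ i) hi)

/-- The ideal generated by the minors of size `r` of the matrices with rows in `K`. -/
def minorIdeal {ι : Type*} (K : Set (ι → R)) (r : ℕ) : Ideal R :=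
  Ideal.span {d | ∃ (v : Fin r → ι → R) (c : Fin r → ι), (∀ i, v i ∈ K) ∧
    d = (Matrix.of fun i j => v i (c j)).det}

theorem det_mem_minorIdeal {ι : Type*} {K : Set (ι → R)} {r : ℕ} (v : Fin r → ι → R)
    (c : Fin r → ι) (hv : ∀ i, v i ∈ K) : (Matrix.of fun i j => v i (c j)).det ∈ minorIdeal K r :=
  Ideal.subset_span ⟨v, c, hv, rfl⟩

theorem minorIdeal_le_iff {ι : Type*} {K : Set (ι → R)} {r : ℕ} {J : Ideal R} :
    minorIdeal K r ≤ J ↔ ∀ (v : Fin r → ι → R) (c : Fin r → ι), (∀ i, v i ∈ K) →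
      (Matrix.of fun i j => v i (c j)).det ∈ J := by
  rw [minorIdeal, Ideal.span_le]
  constructor
  · exact fun h v c hv => h ⟨v, c, hv, rfl⟩
  · rintro h _ ⟨v, c, hv, rfl⟩
    exact h v c hv

theorem minorIdeal_mono {ι : Type*} {K L : Set (ι → R)} (h : K ⊆ L) (r : ℕ) :
    minorIdeal K r ≤ minorIdeal L r :=
  minorIdeal_le_iff.mpr fun v c hv => det_mem_minorIdeal v c fun i => h (hv i)

/-- A minor is multilinear in its rows, so only generators of the row space matter. -/
theorem minorIdeal_span {ι : Type*} (S : Set (ι → R)) (r : ℕ) :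
    minorIdeal (Submodule.span R S : Set (ι → R)) r = minorIdeal S r := by
  refine le_antisymm (minorIdeal_le_iff.mpr fun v c hv => ?_)
    (minorIdeal_mono Submodule.subset_span r)
  exact MultilinearMap.map_mem_of_forall_mem_span
    ((Matrix.detRowAlternating (n := Fin r) (R := R)).toMultilinearMap.compLinearMap
      fun _ => LinearMap.funLeft R R c) S (minorIdeal S r)
    (fun v hv => det_mem_minorIdeal v c hv) v hv

/-- The linear relations between the members of the family `x` with index in `s`. -/
def relationsOn {ι Q : Type*} [Fintype ι] [AddCommGroup Q] [Module R Q] (x : ι → Q)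
    (s : Set ι) : Submodule R (ι → R) where
  carrier := {v | (∀ i ∉ s, v i = 0) ∧ ∑ i, v i • x i = 0}
  add_mem' := by
    rintro v w ⟨h1, h2⟩ ⟨h3, h4⟩
    exact ⟨fun i hi => by simp [h1 i hi, h3 i hi], by
      simp [add_smul, Finset.sum_add_distrib, h2, h4]⟩
  zero_mem' := by simp
  smul_mem' := by
    rintro c v ⟨h1, h2⟩
    exact ⟨fun i hi => by simp [h1 i hi], by simp [mul_smul, ← Finset.smul_sum, h2]⟩

variable {ι Q : Type*} [Fintype ι] [AddCommGroup Q] [Module R Q] (x : ι → Q)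

theorem mem_relationsOn {s : Set ι} {v : ι → R} :
    v ∈ relationsOn x s ↔ (∀ i ∉ s, v i = 0) ∧ ∑ i, v i • x i = 0 := Iff.rfl

/-- Adjoining a redundant generator adds one relation `w` with coefficient 1 at `a`, and raises the
size of the minors by one. Together with the relations on `s`, it generates all relations on `insert
a s`. -/
theorem minorIdeal_relationsOn_insert {s : Set ι} {a : ι} (ha : a ∉ s)
    (hs : x a ∈ Submodule.span R (x '' s)) (r : ℕ) :
    minorIdeal (relationsOn (R := R) x (insert a s) : Set (ι → R)) (r + 1) =
      minorIdeal (relationsOn (R := R) x s : Set (ι → R)) r := by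
  classical
  obtain ⟨b, hb, hbs⟩ : ∃ b : ι → R, (∀ i ∉ s, b i = 0) ∧ ∑ i, b i • x i = x a := by
    obtain ⟨l, hl, hl'⟩ := (Finsupp.mem_span_image_iff_linearCombination R).mp hs
    refine ⟨l, fun i hi => ?_, ?_⟩
    · rw [Finsupp.mem_supported'] at hl
      exact hl i hi
    · rw [← hl', Finsupp.linearCombination_apply, Finsupp.sum_fintype _ _ (by simp)]
  set w : ι → R := Pi.single a 1 - b with hw
  have hwa : w a = 1 := by simp [hw, hb a ha]
  have hwmem : w ∈ relationsOn x (insert a s) := by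
    refine ⟨fun i hi => ?_, ?_⟩
    · simp only [Set.mem_insert_iff, not_or] at hi
      simp [hw, hi.1, hb i hi.2]
    · simp [hw, sub_smul, Finset.sum_sub_distrib, hbs, Pi.single_apply]
  have hle : relationsOn (R := R) x s ≤ relationsOn x (insert a s) := fun v hv =>
    ⟨fun i hi => hv.1 i fun h => hi (Set.mem_insert_of_mem a h), hv.2⟩
  have hspan : (relationsOn (R := R) x (insert a s)) ≤
      Submodule.span R (insert w (relationsOn (R := R) x s : Set (ι → R))) := by
    intro v hv
    have h1 : v - v a • w ∈ relationsOn (R := R) x s := by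
      have h2 := Submodule.sub_mem _ hv (Submodule.smul_mem _ (v a) hwmem)
      refine ⟨fun i hi => ?_, h2.2⟩
      by_cases hia : i = a
      · subst hia; simp [hwa]
      · exact h2.1 i (by simp [hia, hi])
    rw [Submodule.mem_span_insert]
    exact ⟨v a, _, Submodule.subset_span h1, by simp⟩
  apply le_antisymm
  · refine (minorIdeal_mono (L := (Submodule.span R (insert w
      (relationsOn (R := R) x s : Set (ι → R))) : Set (ι → R))) hspan _).trans ?_
    rw [minorIdeal_span]
    refine minorIdeal_le_iff.mpr fun v c hv => ?_
    -- If at most one row is not a relation on `s`, expansion along it leaves minors of relations on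
    -- `s`. Otherwise two rows equal `w` and the determinant vanishes.
    by_cases hrow : ∃ i₀, ∀ i ≠ i₀, v i ∈ relationsOn (R := R) x s
    · obtain ⟨i₀, hi₀⟩ := hrow
      rw [Matrix.det_succ_row _ i₀]
      refine Ideal.sum_mem _ fun j _ => Ideal.mul_mem_left _ _ ?_
      exact det_mem_minorIdeal (fun i => v (i₀.succAbove i)) (fun j' => c (j.succAbove j'))
        fun i => hi₀ _ (Fin.succAbove_ne i₀ i)
    · push Not at hrow
      obtain ⟨i, -, hi⟩ := hrow 0
      obtain ⟨j, hji, hj⟩ := hrow i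
      have e1 : v i = w := (hv i).resolve_right hi
      have e2 : v j = w := (hv j).resolve_right hj
      rw [Matrix.det_zero_of_row_eq hji (by ext k; simp [e1, e2])]
      exact Ideal.zero_mem _
  · refine minorIdeal_le_iff.mpr fun v c hv => ?_
    -- Border the given minor by the row `w` and the column `a`: relations on `s` vanish at `a`, so
    -- the new first column is (1, 0, …, 0).
    have h := det_mem_minorIdeal (K := (relationsOn (R := R) x (insert a s) : Set (ι → R)))
      (Fin.cons w v : Fin (r + 1) → ι → R) (Fin.cons a c) (by
        intro i
        refine Fin.cases hwmem (fun i => hle (hv i)) i)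
    rw [Matrix.det_succ_column_zero, Fin.sum_univ_succ] at h
    rw [Finset.sum_eq_zero (by intro i _; simp [(hv i).1 a ha])] at h
    simpa [hwa, Matrix.submatrix] using h

/-- Since `s` already generates, the other members are redundant and can be adjoined one at a time.
-/
theorem minorIdeal_relationsOn_univ {s : Finset ι}
    (hs : Submodule.span R (x '' s) = ⊤) (r : ℕ) :
    minorIdeal (relationsOn (R := R) x Set.univ : Set (ι → R)) (r + (Fintype.card ι - s.card)) =
      minorIdeal (relationsOn (R := R) x s : Set (ι → R)) r := by
  classical
  obtain ⟨k, hk⟩ : ∃ k, k = sᶜ.card := ⟨_, rfl⟩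
  rw [← Finset.card_compl, ← hk]
  induction k generalizing s r with
  | zero =>
    have : s = Finset.univ := by
      rw [← compl_compl s, Finset.card_eq_zero.mp hk.symm, Finset.compl_empty]
    simp [this]
  | succ k ih =>
    obtain ⟨a, ha⟩ : sᶜ.Nonempty := by rw [← Finset.card_pos]; omega
    have ha' : a ∉ s := Finset.mem_compl.mp ha
    have h := ih (s := insert a s) (by
      rw [eq_top_iff, ← hs]
      exact Submodule.span_mono (Set.image_mono (by simp))) (r + 1) (by
        rw [Finset.compl_insert, Finset.card_erase_of_mem ha]; omega)
    rw [Finset.coe_insert, minorIdeal_relationsOn_insert x (by exact_mod_cast ha')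
      (by rw [hs]; trivial)] at h
    rw [← h]
    congr 1
    omega

/-- Relations supported on the range of `f` are extensions by zero, and a minor using a column
outside the range has a zero column. -/
theorem minorIdeal_relationsOn_comp {κ : Type*} [Fintype κ] (f : κ ↪ ι) (r : ℕ) :
    minorIdeal (relationsOn (R := R) x (Set.range f) : Set (ι → R)) r =
      minorIdeal (relationsOn (R := R) (x ∘ f) Set.univ : Set (κ → R)) r := by
  classical
  have hsum : ∀ v : ι → R, (∀ i ∉ Set.range f, v i = 0) →
      ∑ i, v i • x i = ∑ k, v (f k) • x (f k) := by
    intro v hv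
    rw [← Finset.sum_map Finset.univ f (fun i => v i • x i)]
    refine (Finset.sum_subset (Finset.subset_univ _) fun i _ hi => ?_).symm
    rw [hv i (by simpa using hi), zero_smul]
  apply le_antisymm
  · refine minorIdeal_le_iff.mpr fun v c hv => ?_
    by_cases hc : ∀ j, c j ∈ Set.range f
    · choose c' hc' using hc
      have h := det_mem_minorIdeal
        (K := (relationsOn (R := R) (x ∘ f) Set.univ : Set (κ → R)))
        (fun i => v i ∘ f) c' (fun i => ⟨by simp, by
          have := (hv i).2
          rw [hsum _ (hv i).1] at this
          exact this⟩)
      simpa [hc'] using h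
    · push Not at hc
      obtain ⟨j, hj⟩ := hc
      rw [Matrix.det_eq_zero_of_column_eq_zero j (fun i => (hv i).1 _ hj)]
      exact Ideal.zero_mem _
  · refine minorIdeal_le_iff.mpr fun v c hv => ?_
    have h := det_mem_minorIdeal
      (K := (relationsOn (R := R) x (Set.range f) : Set (ι → R)))
      (fun i => Function.extend f (v i) 0) (f ∘ c) (fun i => by
        have h0 : ∀ k ∉ Set.range f, Function.extend f (v i) 0 k = 0 := fun k hk =>
          Function.extend_apply' _ _ _ hk
        refine ⟨h0, ?_⟩
        rw [hsum _ h0]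
        simpa [f.injective.extend_apply] using (hv i).2)
    simpa [f.injective.extend_apply] using h

/-- Two finite generating families of a module have the same ideals of minors of relations, up to
the shift in size by the number of generators. -/
theorem minorIdeal_relationsOn_eq {κ : Type*} [Fintype κ] (y : κ → Q)
    (hx : Submodule.span R (Set.range x) = ⊤) (hy : Submodule.span R (Set.range y) = ⊤)
    {r s : ℕ} (h : r + Fintype.card κ = s + Fintype.card ι) :
    minorIdeal (relationsOn (R := R) x Set.univ : Set (ι → R)) r =
      minorIdeal (relationsOn (R := R) y Set.univ : Set (κ → R)) s := by
  classical
  -- Both families are compared with their disjoint union, in which each of them is a generating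
  -- subfamily.
  have h1 := minorIdeal_relationsOn_univ (R := R) (Sum.elim x y)
    (s := Finset.univ.map Function.Embedding.inl) (by
      simpa [← Set.range_comp] using hx) r
  have h2 := minorIdeal_relationsOn_univ (R := R) (Sum.elim x y)
    (s := Finset.univ.map Function.Embedding.inr) (by
      simpa [← Set.range_comp] using hy) s
  have h3 := minorIdeal_relationsOn_comp (R := R) (Sum.elim x y) Function.Embedding.inl r
  have h4 := minorIdeal_relationsOn_comp (R := R) (Sum.elim x y) Function.Embedding.inr s
  simp only [Finset.coe_map, Finset.coe_univ, Set.image_univ, Finset.card_map, Finset.card_univ,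
    Fintype.card_sum] at h1 h2
  rw [show r + (Fintype.card ι + Fintype.card κ - Fintype.card ι) =
    s + (Fintype.card ι + Fintype.card κ - Fintype.card κ) by omega] at h1
  rw [h3] at h1
  rw [h4] at h2
  exact h1.symm.trans h2

end Minors

/-! ## Units of Laurent polynomials -/

theorem LaurentPolynomial.exists_eq_of_isUnit {u : ℤ[T;T⁻¹]} (hu : IsUnit u) :
    ∃ (e : ℤˣ) (k : ℤ), u = LaurentPolynomial.C (e : ℤ) * LaurentPolynomial.T k := by
  obtain ⟨v, huv⟩ := hu.exists_right_inv
  obtain ⟨n, p, hp⟩ := LaurentPolynomial.exists_T_pow u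
  obtain ⟨m, q, hq⟩ := LaurentPolynomial.exists_T_pow v
  -- After clearing denominators, the numerator of a unit divides a power of the prime `X` in ℤ[X],
  -- hence is ± a power of `X`.
  have h1 : p * q = Polynomial.X ^ (n + m) := by
    apply Polynomial.toLaurent_injective
    rw [map_mul, hp, hq, Polynomial.toLaurent_X_pow, mul_mul_mul_comm, huv, one_mul,
      ← LaurentPolynomial.T_add, Nat.cast_add]
  obtain ⟨j, -, hj⟩ := (dvd_prime_pow Polynomial.prime_X _).mp (Dvd.intro _ h1)
  obtain ⟨g, hg⟩ := hj.symm
  obtain ⟨e, he, hge⟩ := Polynomial.isUnit_iff.mp g.isUnit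
  obtain ⟨e, rfl⟩ := he
  refine ⟨e, (j : ℤ) - n, ?_⟩
  have h2 : u = Polynomial.toLaurent p * LaurentPolynomial.T (-n) := by
    rw [hp, LaurentPolynomial.mul_T_assoc]; simp
  rw [h2, ← hg, ← hge, map_mul, Polynomial.toLaurent_X_pow, Polynomial.toLaurent_C,
    mul_comm (LaurentPolynomial.T _), mul_assoc, ← LaurentPolynomial.T_add, sub_eq_add_neg]

/-! ## Crossed homomorphisms -/

section Crossed

variable {R G X : Type} [CommRing R] [Group G] [AddCommGroup X] [Module R X]

/-- `δ` is a crossed homomorphism to the module `X`, on which `g` acts as the scalar `τ g`. -/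
def IsCrossedHom (τ : G →* R) (δ : G → X) : Prop :=
  ∀ g h, δ (g * h) = δ g + τ g • δ h

namespace IsCrossedHom

variable {τ : G →* R} {δ : G → X}

theorem map_one (h : IsCrossedHom τ δ) : δ 1 = 0 := by
  have := h 1 1
  simpa using this

theorem smul_map_inv (h : IsCrossedHom τ δ) (g : G) : τ g • δ g⁻¹ = -δ g := by
  have := h g g⁻¹
  rw [mul_inv_cancel, h.map_one] at this
  exact (neg_eq_of_add_eq_zero_right this.symm).symm

theorem map_inv (h : IsCrossedHom τ δ) (g : G) : δ g⁻¹ = -(τ g⁻¹ • δ g) := by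
  have := h g⁻¹ g
  rw [inv_mul_cancel, h.map_one] at this
  exact eq_neg_of_add_eq_zero_left this.symm

/-- This turns relators of the form `a * b⁻¹`, such as the Wirtinger and gluing relators, into
equations between colors. -/
theorem map_mul_inv_eq_zero_iff (h : IsCrossedHom τ δ) {a b : G} (hab : τ a = τ b) :
    δ (a * b⁻¹) = 0 ↔ δ a = δ b := by
  rw [h, hab, h.smul_map_inv, ← sub_eq_add_neg, sub_eq_zero]

theorem comp_hom {H : Type} [Group H] (h : IsCrossedHom τ δ) (f : H →* G) :
    IsCrossedHom (τ.comp f) (δ ∘ f) := fun a b => by simp [h _ _]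

theorem comp_linear {Y : Type} [AddCommGroup Y] [Module R Y] (h : IsCrossedHom τ δ)
    (f : X →ₗ[R] Y) : IsCrossedHom τ (f ∘ δ) := fun a b => by simp [h _ _]

theorem freeGroup_ext {α : Type} {τ : FreeGroup α →* R} {δ δ' : FreeGroup α → X}
    (h : IsCrossedHom τ δ) (h' : IsCrossedHom τ δ')
    (heq : ∀ a, δ (.of a) = δ' (.of a)) : δ = δ' := by
  funext w
  induction w using FreeGroup.induction_on with
  | C1 => rw [h.map_one, h'.map_one]
  | of a => exact heq a
  | inv_of a ih => rw [h.map_inv, h'.map_inv, ih]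
  | mul u v hu hv => rw [h, h', hu, hv]

theorem presentedGroup_ext {α : Type} {rels : Set (FreeGroup α)}
    {τ : PresentedGroup rels →* R} {δ δ' : PresentedGroup rels → X}
    (h : IsCrossedHom τ δ) (h' : IsCrossedHom τ δ')
    (heq : ∀ a, δ (.of a) = δ' (.of a)) : δ = δ' := by
  have := (h.comp_hom (PresentedGroup.mk rels)).freeGroup_ext
    (h'.comp_hom (PresentedGroup.mk rels)) heq
  funext g
  obtain ⟨w, rfl⟩ := PresentedGroup.mk_surjective rels g
  exact congrFun this w

/-- The fundamental formula of the Fox calculus. -/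
theorem eq_sum_foxDeriv {α : Type} [DecidableEq α] [Fintype α] {τ : FreeGroup α →* R}
    {δ : FreeGroup α → X} (h : IsCrossedHom τ δ) (w : FreeGroup α) :
    δ w = ∑ i, MonoidAlgebra.lift ℤ R (FreeGroup α) τ (foxDeriv i w) • δ (.of i) := by
  refine congrFun (h.freeGroup_ext (δ' := fun w => ∑ i,
    MonoidAlgebra.lift ℤ R (FreeGroup α) τ (foxDeriv i w) • δ (.of i)) (fun u v => ?_)
    fun a => ?_) w
  · simp [foxDeriv_mul, add_smul, Finset.sum_add_distrib, mul_smul, Finset.smul_sum]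
  · have : ∀ i, MonoidAlgebra.lift ℤ R (FreeGroup α) τ (foxDeriv i (.of a)) • δ (.of i) =
        if a = i then δ (.of i) else 0 := by
      intro i
      rw [foxDeriv_of]
      split_ifs <;> simp
    simp [this]

end IsCrossedHom

/-- The affine permutation `x ↦ τ(g) x + b`. -/
def affinePerm (τ : G →* R) (g : G) (b : X) : Equiv.Perm X where
  toFun x := τ g • x + b
  invFun x := τ g⁻¹ • (x - b)
  left_inv x := by simp [smul_smul, ← map_mul]
  right_inv x := by simp [smul_smul, ← map_mul]

section Free

variable {α : Type}

/-- The crossed homomorphism on the free group with given values on the generators. -/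
def freeCrossedHom (τ : FreeGroup α →* R) (b : α → X) (w : FreeGroup α) : X :=
  FreeGroup.lift (fun a => affinePerm τ (.of a) (b a)) w 0

/-- Crossed homomorphisms are the translation parts of homomorphisms to the affine permutations of
`X` with linear part `τ`. Their existence thus reduces to the universal property of the free group.
-/
theorem lift_affinePerm_apply (τ : FreeGroup α →* R) (b : α → X) (w : FreeGroup α) (x : X) :
    FreeGroup.lift (fun a => affinePerm τ (.of a) (b a)) w x = τ w • x + freeCrossedHom τ b w := by
  induction w using FreeGroup.induction_on generalizing x with
  | C1 => simp [freeCrossedHom]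
  | of a => simp [freeCrossedHom, affinePerm]
  | inv_of a _ =>
    simp [freeCrossedHom, affinePerm, Equiv.Perm.inv_def, sub_eq_add_neg]
  | mul u v hu hv =>
    rw [freeCrossedHom, map_mul, Equiv.Perm.mul_apply, hv, hu, Equiv.Perm.mul_apply, hu, hv]
    simp [mul_smul, add_assoc]

theorem isCrossedHom_freeCrossedHom (τ : FreeGroup α →* R) (b : α → X) :
    IsCrossedHom τ (freeCrossedHom τ b) := by
  intro u v
  rw [freeCrossedHom, map_mul, Equiv.Perm.mul_apply, lift_affinePerm_apply, add_comm]
  rfl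

@[simp]
theorem freeCrossedHom_of (τ : FreeGroup α →* R) (b : α → X) (a : α) :
    freeCrossedHom τ b (.of a) = b a := by
  simp [freeCrossedHom, affinePerm]

/-- A crossed homomorphism on a free group that vanishes on the relators descends. -/
theorem exists_isCrossedHom_presentedGroup {rels : Set (FreeGroup α)}
    (τ : PresentedGroup rels →* R) (b : α → X)
    (h : ∀ r ∈ rels, freeCrossedHom (τ.comp (PresentedGroup.mk rels)) b r = 0) :
    ∃ δ : PresentedGroup rels → X, IsCrossedHom τ δ ∧ ∀ a, δ (.of a) = b a := by
  -- A relator acts with linear part 1, being trivial in the group, and with translation part 0 by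
  -- `h`. The affine action therefore descends.
  have h1 : ∀ r ∈ rels, FreeGroup.lift
      (fun a => affinePerm (τ.comp (PresentedGroup.mk rels)) (.of a) (b a)) r = 1 := by
    intro r hr
    ext x
    rw [lift_affinePerm_apply, h r hr, MonoidHom.comp_apply, PresentedGroup.one_of_mem hr]
    simp
  have h2 : ∀ w, PresentedGroup.toGroup h1 (PresentedGroup.mk rels w) = FreeGroup.lift
      (fun a => affinePerm (τ.comp (PresentedGroup.mk rels)) (.of a) (b a)) w := fun _ => rfl
  refine ⟨fun g => PresentedGroup.toGroup h1 g 0, fun g g' => ?_, fun a => ?_⟩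
  · obtain ⟨w, rfl⟩ := PresentedGroup.mk_surjective rels g
    obtain ⟨w', rfl⟩ := PresentedGroup.mk_surjective rels g'
    simp only [← map_mul, h2]
    exact isCrossedHom_freeCrossedHom (τ.comp (PresentedGroup.mk rels)) b w w'
  · exact (congrArg (fun f : Equiv.Perm X => f 0) (PresentedGroup.toGroup.of h1)).trans
      (by simp [affinePerm])

end Free

/-- The crossed homomorphism `δ` is universal. -/
def IsUniversalCrossedHom (τ : G →* R) (δ : G → X) : Prop :=
  IsCrossedHom τ δ ∧ ∀ (Y : Type) [AddCommGroup Y] [Module R Y] (δ' : G → Y),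
    IsCrossedHom τ δ' → ∃ f : X →ₗ[R] Y, ∀ g, f (δ g) = δ' g

end Crossed

/-! ## The first elementary ideal and the Alexander module -/

namespace FinitePresentation

variable {Γ : Type} [Group Γ] (P : FinitePresentation Γ)

/-- The projection of the free group to the presented group. -/
def proj : FreeGroup (Fin P.numGens) →* Γ :=
  P.iso.toMonoidHom.comp (PresentedGroup.mk (Set.range P.rel))

theorem proj_surjective : Function.Surjective P.proj :=
  P.iso.surjective.comp (PresentedGroup.mk_surjective _)

theorem proj_rel (i : Fin P.numRels) : P.proj (P.rel i) = 1 := by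
  rw [proj, MonoidHom.comp_apply, PresentedGroup.one_of_mem (Set.mem_range_self i), map_one]

variable (χ : Γ →* Multiplicative ℤ)

theorem firstElementaryIdeal_eq_minorIdeal :
    P.firstElementaryIdeal χ =
      minorIdeal (Set.range fun i => P.alexanderMatrix χ i) (P.numGens - 1) := by
  rw [firstElementaryIdeal, minorIdeal]
  congr 1
  ext d
  constructor
  · rintro ⟨r, c, rfl⟩
    exact ⟨fun i => P.alexanderMatrix χ (r i), c, fun i => ⟨r i, rfl⟩, rfl⟩
  · rintro ⟨v, c, hv, rfl⟩
    choose r hr using hv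
    refine ⟨r, c, ?_⟩
    congr 1
    ext i j
    simp [← hr]

variable {X : Type} [AddCommGroup X] [Module ℤ[T;T⁻¹] X] {δ : Γ → X}

theorem span_range_eq_top (hδ : IsCrossedHom ((AddMonoidAlgebra.of ℤ ℤ).comp χ) δ)
    (hspan : Submodule.span ℤ[T;T⁻¹] (Set.range δ) = ⊤) :
    Submodule.span ℤ[T;T⁻¹] (Set.range fun j => δ (P.proj (.of j))) = ⊤ := by
  rw [eq_top_iff, ← hspan, Submodule.span_le]
  rintro _ ⟨g, rfl⟩
  obtain ⟨w, rfl⟩ := P.proj_surjective g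
  have h : δ (P.proj w) = _ := (hδ.comp_hom P.proj).eq_sum_foxDeriv w
  rw [h]
  exact Submodule.sum_mem _ fun i _ => Submodule.smul_mem _ _ (Submodule.subset_span ⟨i, rfl⟩)

/-- Applied to a relator, where δ vanishes, the fundamental formula makes each row a relation.
Conversely, the quotient of the free module by the rows carries a crossed homomorphism sending
generators to basis classes. By universality every relation between the values of `δ` holds there,
so it lies in the row span. -/
theorem relationsOn_eq_span
    (hδ : IsUniversalCrossedHom ((AddMonoidAlgebra.of ℤ ℤ).comp χ) δ) :
    relationsOn (R := ℤ[T;T⁻¹]) (fun j => δ (P.proj (.of j))) Set.univ =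
      Submodule.span ℤ[T;T⁻¹] (Set.range fun i => P.alexanderMatrix χ i) := by
  set S := Submodule.span ℤ[T;T⁻¹] (Set.range fun i => P.alexanderMatrix χ i) with hS
  set τ := (AddMonoidAlgebra.of ℤ ℤ).comp χ
  apply le_antisymm
  · have hsum : ∀ v : Fin P.numGens → ℤ[T;T⁻¹],
        ∑ j, v j • S.mkQ (Pi.single j 1) = S.mkQ v := by
      intro v
      simp_rw [← map_smul, ← map_sum]
      congr 1
      ext k
      simp [Finset.sum_apply, Pi.single_apply]
    obtain ⟨δ₀, hδ₀, hb⟩ := exists_isCrossedHom_presentedGroup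
      (rels := Set.range P.rel) (τ.comp P.iso.toMonoidHom)
      (fun j => S.mkQ (Pi.single j 1)) (by
        rintro _ ⟨i, rfl⟩
        rw [(isCrossedHom_freeCrossedHom _ _).eq_sum_foxDeriv]
        simp only [freeCrossedHom_of]
        have := hsum (P.alexanderMatrix χ i)
        refine this.trans ?_
        rw [Submodule.mkQ_apply, Submodule.Quotient.mk_eq_zero]
        exact Submodule.subset_span ⟨i, rfl⟩)
    obtain ⟨f, hf⟩ := hδ.2 _ (δ₀ ∘ P.iso.symm) (by
      intro g h
      have := hδ₀ (P.iso.symm g) (P.iso.symm h)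
      simpa using this)
    intro v hv
    have h1 := congrArg f ((mem_relationsOn _).mp hv).2
    have h2 : ∀ j, f (δ (P.proj (.of j))) = S.mkQ (Pi.single j 1) := by
      intro j
      rw [hf, ← hb]
      simp only [Function.comp_apply, proj, MonoidHom.comp_apply]
      congr 1
      exact P.iso.symm_apply_apply _
    rw [map_sum, map_zero] at h1
    simp_rw [map_smul, h2] at h1
    rw [hsum, Submodule.mkQ_apply, Submodule.Quotient.mk_eq_zero] at h1
    exact h1
  · rw [hS, Submodule.span_le]
    rintro _ ⟨i, rfl⟩
    refine ⟨by simp, ?_⟩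
    have h := (hδ.1.comp_hom P.proj).eq_sum_foxDeriv (P.rel i)
    rw [Function.comp_apply, P.proj_rel, hδ.1.map_one] at h
    exact h.symm

/-- The first elementary ideal is computed by any generators of the Alexander module. -/
theorem firstElementaryIdeal_eq {n : ℕ} (q : Fin (n + 1) → X)
    (hδ : IsUniversalCrossedHom ((AddMonoidAlgebra.of ℤ ℤ).comp χ) δ)
    (hspan : Submodule.span ℤ[T;T⁻¹] (Set.range δ) = ⊤)
    (hq : Submodule.span ℤ[T;T⁻¹] (Set.range q) = ⊤) (hP : P.numGens ≠ 0) :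
    P.firstElementaryIdeal χ =
      minorIdeal (relationsOn (R := ℤ[T;T⁻¹]) q Set.univ : Set (Fin (n + 1) → ℤ[T;T⁻¹])) n := by
  rw [firstElementaryIdeal_eq_minorIdeal, ← minorIdeal_span, ← P.relationsOn_eq_span χ hδ]
  -- The sizes match because `hP` makes the truncated difference `P.numGens - 1` a true one.
  refine minorIdeal_relationsOn_eq _ q (P.span_range_eq_top χ hδ.1 hspan) hq ?_
  simp
  omega

theorem numGens_ne_zero (hχ : χ ≠ 1) : P.numGens ≠ 0 := by
  intro h
  apply hχ
  have : IsEmpty (Fin P.numGens) := by rw [h]; infer_instance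
  ext g
  obtain ⟨w, rfl⟩ := P.proj_surjective g
  rw [Subsingleton.elim w 1]
  simp

end FinitePresentation

/-! ## Finite presentations from finite lists of relators -/

theorem nonempty_finitePresentation {α : Type} [Finite α] (l : List (FreeGroup α)) :
    Nonempty (FinitePresentation (PresentedGroup {r | r ∈ l})) := by
  obtain ⟨n, ⟨e⟩⟩ := Finite.exists_equiv_fin α
  refine ⟨⟨n, l.length, fun i => FreeGroup.freeGroupCongr e (l.get i), ?_⟩⟩
  refine MulEquiv.trans ?_ (PresentedGroup.equivPresentedGroup {r | r ∈ l} e).symm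
  have : Set.range (fun i => FreeGroup.freeGroupCongr e (l.get i)) =
      FreeGroup.freeGroupCongr e '' {r | r ∈ l} := by
    ext r
    simp [List.mem_iff_get]
  rw [this]

/-! ## Colorings of tangle diagrams -/

section Coloring

variable {R X : Type} [CommRing R] [AddCommGroup X] [Module R X] (t : Rˣ)

/-- The homomorphism that sends every generator to the unit `t`. -/
def freeDegree (α : Type) : FreeGroup α →* R :=
  (Units.coeHom R).comp (FreeGroup.lift fun _ => t)

@[simp]
theorem freeDegree_of {α : Type} (a : α) : freeDegree t α (.of a) = t := by
  simp [freeDegree]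

@[simp]
theorem freeDegree_inv_of {α : Type} (a : α) :
    freeDegree t α (.of a)⁻¹ = ((t⁻¹ : Rˣ) : R) := by
  simp [freeDegree]

/-- Relators of a composite diagram are relabelled relators of its pieces; this is what lets
colorings be restricted to the pieces. -/
theorem freeCrossedHom_map {α β : Type} (f : α → β) (c : β → X) (r : FreeGroup α) :
    freeCrossedHom (freeDegree t β) c (FreeGroup.map f r) =
      freeCrossedHom (freeDegree t α) (c ∘ f) r := by
  have hd : (freeDegree t β).comp (FreeGroup.map f) = freeDegree t α := by
    ext a
    simp
  have h := (isCrossedHom_freeCrossedHom (freeDegree t β) c).comp_hom (FreeGroup.map f)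
  rw [hd] at h
  exact congrFun (h.freeGroup_ext (isCrossedHom_freeCrossedHom _ (c ∘ f)) fun a => by simp) r

namespace TangleDiagram

/-- A coloring of the arcs of `T` by elements of `X`: at each crossing the Fox differential of
the Wirtinger relation holds. -/
def IsColoring (T : TangleDiagram) (c : T.Arc → X) : Prop :=
  ∀ r ∈ T.wirtingerRels, freeCrossedHom (freeDegree t T.Arc) c r = 0

variable {t}

theorem length_bottomArcs (T : TangleDiagram) : T.bottomArcs.length = T.source.length := by
  induction T <;> simp_all [bottomArcs, source]

theorem length_topArcs (T : TangleDiagram) : T.topArcs.length = T.target.length := by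
  induction T <;> simp_all [topArcs, target]

/-- The gluing relators linearize to equality of colors along the common boundary. By `h` the two
boundary lists have equal length, so `List.zipWith` drops nothing. -/
theorem isColoring_comp {T' T : TangleDiagram} (h : T.target = T'.source)
    {c : (comp T' T).Arc → X} :
    IsColoring t (comp T' T) c ↔ IsColoring t T' (c ∘ Arc.upper) ∧
      IsColoring t T (c ∘ Arc.lower) ∧
      T.topArcs.map (c ∘ Arc.lower) = T'.bottomArcs.map (c ∘ Arc.upper) := by
  have hz : ∀ (l : List T.Arc) (l' : List T'.Arc), l.length = l'.length →
      ((∀ r ∈ List.zipWith (fun x y => FreeGroup.of (Arc.lower (T' := T') x) *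
        (FreeGroup.of (Arc.upper (T := T) y))⁻¹) l l',
        freeCrossedHom (freeDegree t _) c r = 0) ↔
      l.map (c ∘ Arc.lower) = l'.map (c ∘ Arc.upper)) := by
    intro l
    induction l with
    | nil =>
      intro l' hl
      obtain rfl : l' = [] := List.length_eq_zero_iff.mp hl.symm
      simp
    | cons a l ih =>
      intro l' hl
      cases l' with
      | nil => simp at hl
      | cons a' l' =>
        simp only [List.zipWith_cons_cons, List.forall_mem_cons, List.map_cons, List.cons.injEq,
          ih l' (by simpa using hl)]
        rw [(isCrossedHom_freeCrossedHom _ c).map_mul_inv_eq_zero_iff (by simp)]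
        simp
  rw [IsColoring, wirtingerRels, List.forall_mem_append, List.forall_mem_append, hz _ _ (by
    rw [length_topArcs, length_bottomArcs, h]), and_assoc]
  simp only [List.forall_mem_map, freeCrossedHom_map, IsColoring]

theorem isColoring_tensor {T T' : TangleDiagram} {c : (tensor T T').Arc → X} :
    IsColoring t (tensor T T') c ↔ IsColoring t T (c ∘ Arc.left) ∧
      IsColoring t T' (c ∘ Arc.right) := by
  rw [IsColoring, wirtingerRels, List.forall_mem_append]
  simp only [List.forall_mem_map, freeCrossedHom_map, IsColoring]

/-- For overpass color a and incoming color b, the Fox differential of xyx⁻¹ is (1 - t)a + tb, the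
first row of the Burau block. The second row says that the overpass keeps its color. -/
theorem isColoring_xPos {c : xPos.Arc → X} :
    IsColoring t xPos c ↔
      c .posUnderOut = (1 - (t : R)) • c .posOver + (t : R) • c .posUnderIn := by
  have h := isCrossedHom_freeCrossedHom (freeDegree t _) c
  simp only [IsColoring, wirtingerRels, List.forall_mem_singleton]
  rw [h.map_mul_inv_eq_zero_iff (by simp), h, h, h.map_inv]
  simp only [freeCrossedHom_of, map_mul, freeDegree_of, freeDegree_inv_of, smul_neg, smul_smul]
  rw [mul_assoc, Units.mul_inv, mul_one, eq_comm, sub_smul, one_smul]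
  constructor <;> intro h <;> rw [h] <;> abel

theorem isColoring_xNeg {c : xNeg.Arc → X} :
    IsColoring t xNeg c ↔ c .negUnderOut =
      ((t⁻¹ : Rˣ) : R) • c .negUnderIn + (1 - ((t⁻¹ : Rˣ) : R)) • c .negOver := by
  have h := isCrossedHom_freeCrossedHom (freeDegree t _) c
  simp only [IsColoring, wirtingerRels, List.forall_mem_singleton]
  rw [h.map_mul_inv_eq_zero_iff (by simp), h, h, h.map_inv]
  simp only [freeCrossedHom_of, map_mul, freeDegree_of, freeDegree_inv_of]
  rw [Units.inv_mul, one_smul, eq_comm, sub_smul, one_smul]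
  constructor <;> intro h <;> rw [h] <;> abel

theorem exists_comp_coloring {T' T : TangleDiagram} (h : T.target = T'.source)
    {c' : T'.Arc → X} {c : T.Arc → X} (hc' : IsColoring t T' c') (hc : IsColoring t T c)
    (hcc : T.topArcs.map c = T'.bottomArcs.map c') :
    ∃ d : (comp T' T).Arc → X, IsColoring t (comp T' T) d ∧ d ∘ Arc.upper = c' ∧
      d ∘ Arc.lower = c := by
  let d : (comp T' T).Arc → X := fun a => match a with
    | .upper a => c' a
    | .lower a => c a
  exact ⟨d, (isColoring_comp h).mpr ⟨hc', hc, hcc⟩, rfl, rfl⟩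

theorem exists_tensor_coloring {T T' : TangleDiagram}
    {c : T.Arc → X} {c' : T'.Arc → X} (hc : IsColoring t T c) (hc' : IsColoring t T' c') :
    ∃ d : (tensor T T').Arc → X, IsColoring t (tensor T T') d ∧ d ∘ Arc.left = c ∧
      d ∘ Arc.right = c' := by
  let d : (tensor T T').Arc → X := fun a => match a with
    | .left a => c a
    | .right a => c' a
  exact ⟨d, isColoring_tensor.mpr ⟨hc, hc'⟩, rfl, rfl⟩

theorem isColoring_id (ε : List Strand) (c : (id ε).Arc → X) : IsColoring t (id ε) c := by
  simp [IsColoring, wirtingerRels]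

theorem exists_id_coloring {Y : Type} (ε : List Strand) (l : List Y)
    (h : l.length = ε.length) : ∃ c : (id ε).Arc → Y, (id ε).bottomArcs.map c = l := by
  refine ⟨fun a => match a with | .strand _ i => l[i], ?_⟩
  apply List.ext_getElem
  · simp [bottomArcs, h]
  · intro k h1 h2
    simp [bottomArcs]

theorem topArcs_id (ε : List Strand) : (id ε).topArcs = (id ε).bottomArcs := rfl

/-! ### Colorings determined by the colors along the boundary -/

variable (R X t) in
/-- A coloring is determined by the colors along the bottom. -/
def BottomDetermined (T : TangleDiagram) : Prop :=
  ∀ c c' : T.Arc → X, IsColoring t T c → IsColoring t T c' →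
    T.bottomArcs.map c = T.bottomArcs.map c' → c = c'

variable (R X t) in
/-- A coloring is determined by the colors along the top. -/
def TopDetermined (T : TangleDiagram) : Prop :=
  ∀ c c' : T.Arc → X, IsColoring t T c → IsColoring t T c' →
    T.topArcs.map c = T.topArcs.map c' → c = c'

theorem bottomDetermined_id (ε : List Strand) : BottomDetermined R X t (id ε) := by
  intro c c' _ _ h
  funext a
  obtain ⟨_, i⟩ := a
  exact List.map_inj_left.mp h _ (by simp [bottomArcs])

theorem bottomDetermined_xPos : BottomDetermined R X t xPos := by
  intro c c' hc hc' h
  rw [isColoring_xPos] at hc hc'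
  simp only [bottomArcs, List.map_cons, List.map_nil, List.cons.injEq, and_true] at h
  funext a
  cases a
  · exact h.1
  · exact h.2
  · rw [hc, hc', h.1, h.2]

theorem bottomDetermined_xNeg : BottomDetermined R X t xNeg := by
  intro c c' hc hc' h
  rw [isColoring_xNeg] at hc hc'
  simp only [bottomArcs, List.map_cons, List.map_nil, List.cons.injEq, and_true] at h
  funext a
  cases a
  · exact h.2
  · exact h.1
  · rw [hc, hc', h.1, h.2]

theorem BottomDetermined.comp {T' T : TangleDiagram} (h : T.target = T'.source)
    (h1 : BottomDetermined R X t T') (h2 : BottomDetermined R X t T) :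
    BottomDetermined R X t (comp T' T) := by
  intro c c' hc hc' hb
  obtain ⟨a1, a2, a3⟩ := (isColoring_comp h).mp hc
  obtain ⟨b1, b2, b3⟩ := (isColoring_comp h).mp hc'
  have e1 := h2 _ _ a2 b2 (by simpa [bottomArcs] using hb)
  have e2 := h1 _ _ a1 b1 (by rw [← a3, ← b3, e1])
  funext a
  cases a with
  | upper a => exact congrFun e2 a
  | lower a => exact congrFun e1 a

theorem BottomDetermined.tensor {T T' : TangleDiagram}
    (h1 : BottomDetermined R X t T) (h2 : BottomDetermined R X t T') :
    BottomDetermined R X t (tensor T T') := by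
  intro c c' hc hc' hb
  obtain ⟨a1, a2⟩ := isColoring_tensor.mp hc
  obtain ⟨b1, b2⟩ := isColoring_tensor.mp hc'
  simp only [bottomArcs, List.map_append, List.map_map] at hb
  obtain ⟨e1, e2⟩ := List.append_inj hb (by simp)
  have e1 := h1 _ _ a1 b1 e1
  have e2 := h2 _ _ a2 b2 e2
  funext a
  cases a with
  | left a => exact congrFun e1 a
  | right a => exact congrFun e2 a

theorem TopDetermined.comp {T' T : TangleDiagram} (h : T.target = T'.source)
    (h1 : TopDetermined R X t T') (h2 : TopDetermined R X t T) :
    TopDetermined R X t (comp T' T) := by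
  intro c c' hc hc' hb
  obtain ⟨a1, a2, a3⟩ := (isColoring_comp h).mp hc
  obtain ⟨b1, b2, b3⟩ := (isColoring_comp h).mp hc'
  have e1 := h1 _ _ a1 b1 (by simpa [topArcs] using hb)
  have e2 := h2 _ _ a2 b2 (by rw [a3, b3, e1])
  funext a
  cases a with
  | upper a => exact congrFun e1 a
  | lower a => exact congrFun e2 a

theorem TopDetermined.tensor {T T' : TangleDiagram}
    (h1 : TopDetermined R X t T) (h2 : TopDetermined R X t T') :
    TopDetermined R X t (tensor T T') := by
  intro c c' hc hc' hb
  obtain ⟨a1, a2⟩ := isColoring_tensor.mp hc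
  obtain ⟨b1, b2⟩ := isColoring_tensor.mp hc'
  simp only [topArcs, List.map_append, List.map_map] at hb
  obtain ⟨e1, e2⟩ := List.append_inj hb (by simp)
  have e1 := h1 _ _ a1 b1 e1
  have e2 := h2 _ _ a2 b2 e2
  funext a
  cases a with
  | left a => exact congrFun e1 a
  | right a => exact congrFun e2 a

theorem bottomDetermined_ofLetter {n : ℕ} (p : Fin (n - 1) × Bool) :
    BottomDetermined R X t (ofLetter p) := by
  refine .tensor (.tensor (bottomDetermined_id _) ?_) (bottomDetermined_id _)
  split_ifs
  · exact bottomDetermined_xPos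
  · exact bottomDetermined_xNeg

theorem bottomDetermined_ofWord {n : ℕ} (w : List (Fin (n - 1) × Bool)) :
    BottomDetermined R X t (ofWord w) := by
  induction w with
  | nil => exact bottomDetermined_id _
  | cons p w ih =>
    exact .comp (by rw [(ofWord_spec w).2.2, (ofLetter_spec p).2.1])
      (bottomDetermined_ofLetter p) ih

/-- Caps are determined from below and cups from above, so a closed braid is determined by the
colors at the bottom of the braid. -/
theorem bottomDetermined_ev (n : ℕ) : BottomDetermined R X t (ev n) := by
  induction n with
  | zero => exact bottomDetermined_id _
  | succ n ih =>
    refine .comp (by simp [source, target, ev_spec]) ?_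
      (.tensor (.tensor (bottomDetermined_id _) ih) (bottomDetermined_id _))
    intro c c' _ _ h
    simp only [bottomArcs, List.map_cons, List.cons.injEq] at h
    funext a
    cases a
    exact h.1

theorem topDetermined_coev (n : ℕ) : TopDetermined R X t (coev n) := by
  induction n with
  -- Top and bottom arcs of an identity diagram coincide, so both notions of determinacy agree for
  -- it.
  | zero => exact bottomDetermined_id _
  | succ n ih =>
    refine .comp (by simp [source, target, coev_spec])
      (.tensor (.tensor (bottomDetermined_id _) ih) (bottomDetermined_id _)) ?_
    intro c c' _ _ h
    simp only [topArcs, List.map_cons, List.cons.injEq] at h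
    funext a
    cases a
    exact h.1

/-! ### Colorings of nested cups and caps -/

theorem topArcs_eq_nil {T : TangleDiagram} (h : T.target = []) : T.topArcs = [] :=
  List.length_eq_zero_iff.mp (by rw [length_topArcs, h]; rfl)

theorem bottomArcs_eq_nil {T : TangleDiagram} (h : T.source = []) : T.bottomArcs = [] :=
  List.length_eq_zero_iff.mp (by rw [length_bottomArcs, h]; rfl)

theorem map_bottomArcs_comp {Y : Type} {T' T : TangleDiagram} (c : (comp T' T).Arc → Y) :
    (comp T' T).bottomArcs.map c = T.bottomArcs.map (c ∘ Arc.lower) := by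
  simp [bottomArcs]

theorem map_topArcs_comp {Y : Type} {T' T : TangleDiagram} (c : (comp T' T).Arc → Y) :
    (comp T' T).topArcs.map c = T'.topArcs.map (c ∘ Arc.upper) := by
  simp [topArcs]

theorem map_bottomArcs_tensor {Y : Type} {T T' : TangleDiagram} (c : (tensor T T').Arc → Y) :
    (tensor T T').bottomArcs.map c =
      T.bottomArcs.map (c ∘ Arc.left) ++ T'.bottomArcs.map (c ∘ Arc.right) := by
  simp [bottomArcs]

theorem map_topArcs_tensor {Y : Type} {T T' : TangleDiagram} (c : (tensor T T').Arc → Y) :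
    (tensor T T').topArcs.map c =
      T.topArcs.map (c ∘ Arc.left) ++ T'.topArcs.map (c ∘ Arc.right) := by
  simp [topArcs]

/-- The vertical strands added at each stage of `ev` and `coev` have the same color at both ends. -/
theorem frame_colors {Y : Type} (T : TangleDiagram) (s s' : Strand)
    (c : (tensor (tensor (id [s]) T) (id [s'])).Arc → Y) : ∃ a b : Y,
    (bottomArcs _).map c = [a] ++ T.bottomArcs.map ((c ∘ Arc.left) ∘ Arc.right) ++ [b] ∧
    (topArcs _).map c = [a] ++ T.topArcs.map ((c ∘ Arc.left) ∘ Arc.right) ++ [b] := by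
  refine ⟨c (.left (.left (.strand [s] 0))), c (.right (.strand [s'] 0)), ?_⟩
  rw [map_bottomArcs_tensor, map_bottomArcs_tensor, map_topArcs_tensor, map_topArcs_tensor]
  exact ⟨rfl, rfl⟩

theorem exists_frame_coloring (T : TangleDiagram) (s s' : Strand) (a b : X) {c : T.Arc → X}
    (hc : IsColoring t T c) : ∃ d : (tensor (tensor (id [s]) T) (id [s'])).Arc → X,
    IsColoring t _ d ∧
    (bottomArcs _).map d = [a] ++ T.bottomArcs.map c ++ [b] ∧
    (topArcs _).map d = [a] ++ T.topArcs.map c ++ [b] := by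
  obtain ⟨d₁, h1, h2, h3⟩ := exists_tensor_coloring
    (isColoring_id (t := t) [s] (fun _ => a)) hc
  obtain ⟨d, h4, h5, h6⟩ := exists_tensor_coloring h1 (isColoring_id (t := t) [s'] (fun _ => b))
  refine ⟨d, h4, ?_⟩
  rw [map_bottomArcs_tensor, map_bottomArcs_tensor, map_topArcs_tensor, map_topArcs_tensor,
    h5, h6, h2, h3]
  exact ⟨rfl, rfl⟩

/-- Each cap joins a position to its mirror image and consists of one arc, so the boundary colors
form a palindrome. -/
theorem IsColoring.exists_bottom_ev {n : ℕ} {c : (ev n).Arc → X} (hc : IsColoring t (ev n) c) :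
    ∃ l : List X, l.length = n ∧ (ev n).bottomArcs.map c = l ++ l.reverse := by
  induction n with
  | zero => exact ⟨[], rfl, rfl⟩
  | succ n ih =>
    change (comp capPosNeg (tensor (tensor (id [.pos]) (ev n)) (id [.neg]))).Arc → X at c
    obtain ⟨-, h2, h3⟩ := (isColoring_comp (by simp [source, target, ev_spec])).mp hc
    obtain ⟨l, hl, hl'⟩ := ih (isColoring_tensor.mp (isColoring_tensor.mp h2).1).2
    obtain ⟨a, b, e1, e2⟩ := frame_colors (ev n) .pos .neg (c ∘ Arc.lower)
    rw [e2, topArcs_eq_nil (ev_spec n).2.2] at h3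
    simp only [bottomArcs, List.map_cons, List.map_nil, List.append_nil, List.singleton_append,
      List.cons.injEq, and_true] at h3
    obtain ⟨rfl, rfl⟩ := h3
    refine ⟨(c ∘ Arc.upper) .capPN :: l, by simp [hl], ?_⟩
    refine (map_bottomArcs_comp _).trans ?_
    rw [e1, hl']
    simp

theorem exists_coloring_ev {n : ℕ} (l : List X) (hl : l.length = n) :
    ∃ c : (ev n).Arc → X, IsColoring t (ev n) c ∧
      (ev n).bottomArcs.map c = l ++ l.reverse := by
  induction n generalizing l with
  | zero =>
    obtain rfl := List.length_eq_zero_iff.mp hl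
    exact ⟨fun _ => 0, isColoring_id _ _, rfl⟩
  | succ n ih =>
    obtain ⟨a, l, rfl⟩ := List.exists_cons_of_length_eq_add_one hl
    obtain ⟨c, hc, hcl⟩ := ih l (by simpa using hl)
    obtain ⟨d, hd, hd1, hd2⟩ := exists_frame_coloring (ev n) .pos .neg a a hc
    obtain ⟨e, he, -, he2⟩ := exists_comp_coloring (T' := capPosNeg) (c' := fun _ => a)
      (by simp [source, target, ev_spec]) (by simp [IsColoring, wirtingerRels]) hd (by
        rw [hd2, topArcs_eq_nil (ev_spec n).2.2]; rfl)
    refine ⟨e, he, ?_⟩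
    refine (map_bottomArcs_comp _).trans ?_
    rw [he2, hd1, hcl]
    simp

theorem IsColoring.exists_top_coev {n : ℕ} {c : (coev n).Arc → X}
    (hc : IsColoring t (coev n) c) :
    ∃ l : List X, l.length = n ∧ (coev n).topArcs.map c = l ++ l.reverse := by
  induction n with
  | zero => exact ⟨[], rfl, rfl⟩
  | succ n ih =>
    change (comp (tensor (tensor (id [.pos]) (coev n)) (id [.neg])) cupPosNeg).Arc → X at c
    obtain ⟨h2, -, h3⟩ := (isColoring_comp (by simp [source, target, coev_spec])).mp hc
    obtain ⟨l, hl, hl'⟩ := ih (isColoring_tensor.mp (isColoring_tensor.mp h2).1).2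
    obtain ⟨a, b, e1, e2⟩ := frame_colors (coev n) .pos .neg (c ∘ Arc.upper)
    rw [e1, bottomArcs_eq_nil (coev_spec n).2.1] at h3
    simp only [topArcs, List.map_cons, List.map_nil, List.append_nil, List.singleton_append,
      List.cons.injEq, and_true] at h3
    obtain ⟨rfl, rfl⟩ := h3
    refine ⟨(c ∘ Arc.lower) .cupPN :: l, by simp [hl], ?_⟩
    refine (map_topArcs_comp _).trans ?_
    rw [e2, hl']
    simp

theorem exists_coloring_coev {n : ℕ} (l : List X) (hl : l.length = n) :
    ∃ c : (coev n).Arc → X, IsColoring t (coev n) c ∧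
      (coev n).topArcs.map c = l ++ l.reverse := by
  induction n generalizing l with
  | zero =>
    obtain rfl := List.length_eq_zero_iff.mp hl
    exact ⟨fun _ => 0, isColoring_id _ _, rfl⟩
  | succ n ih =>
    obtain ⟨a, l, rfl⟩ := List.exists_cons_of_length_eq_add_one hl
    obtain ⟨c, hc, hcl⟩ := ih l (by simpa using hl)
    obtain ⟨d, hd, hd1, hd2⟩ := exists_frame_coloring (coev n) .pos .neg a a hc
    obtain ⟨e, he, he2, -⟩ := exists_comp_coloring (T := cupPosNeg) (c := fun _ => a)
      (by simp [source, target, coev_spec]) hd (by simp [IsColoring, wirtingerRels]) (by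
        rw [hd1, bottomArcs_eq_nil (coev_spec n).2.1]; rfl)
    refine ⟨e, he, ?_⟩
    refine (map_topArcs_comp _).trans ?_
    rw [he2, hd2, hcl]
    simp

end TangleDiagram

/-! ### Colorings of braids -/

variable (R) in
/-- The action of the letter `p` of a braid word on colors. -/
def letterAct {n : ℕ} (p : Fin (n - 1) × Bool) (x : Fin n → X) (k : Fin n) : X :=
  if (k : ℕ) = p.1 then
    if p.2 then (1 - (t : R)) • x ⟨p.1, by omega⟩ + (t : R) • x ⟨p.1 + 1, by omega⟩
    else x ⟨p.1 + 1, by omega⟩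
  else if (k : ℕ) = p.1 + 1 then
    if p.2 then x ⟨p.1, by omega⟩
    else ((t⁻¹ : Rˣ) : R) • x ⟨p.1, by omega⟩ + (1 - ((t⁻¹ : Rˣ) : R)) • x ⟨p.1 + 1, by omega⟩
  else x k

variable (R) in
/-- The action of a braid word on colors, the last letter acting first. -/
def wordAct {n : ℕ} (w : List (Fin (n - 1) × Bool)) (x : Fin n → X) : Fin n → X :=
  w.foldr (letterAct R t) x

/-- Translates the boundary lists of `id ⊗ X± ⊗ id` into coordinates: a crossing changes only the
entries `i` and `i + 1`. -/
theorem List.eq_of_append_pair_eq_ofFn {Y : Type} {n i : ℕ} (hi : i + 1 < n) {U V : List Y}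
    {a b : Y} (hU : U.length = i) {x : Fin n → Y} (h : U ++ [a, b] ++ V = List.ofFn x) :
    a = x ⟨i, by omega⟩ ∧ b = x ⟨i + 1, hi⟩ ∧ ∀ a' b' : Y, U ++ [a', b'] ++ V =
      List.ofFn fun k : Fin n => if (k : ℕ) = i then a' else if (k : ℕ) = i + 1 then b' else x k := by
  have hx : ∀ k : Fin n, (U ++ [a, b] ++ V)[(k : ℕ)]? = some (x k) := by
    intro k
    rw [h]
    simp
  have hl : (U ++ [a, b] ++ V).length = n := by rw [h]; simp
  refine ⟨?_, ?_, fun a' b' => ?_⟩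
  · have := hx ⟨i, by omega⟩
    simpa [List.getElem?_append, hU] using this
  · have := hx ⟨i + 1, hi⟩
    simpa [List.getElem?_append, hU] using this
  · apply List.ext_getElem?
    intro k
    by_cases hk : k < n
    · have := hx ⟨k, hk⟩
      rw [List.getElem?_ofFn]
      simp only [List.getElem?_append, List.length_append, List.length_cons, List.length_nil,
        hU] at this ⊢
      by_cases h1 : k = i
      · subst h1; simp [hk]
      · by_cases h2 : k = i + 1
        · subst h2; simp [hk]
        · by_cases h3 : k < i
          · simpa [hk, h1, h2, h3, show k < i + 2 by omega, hU] using this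
          · simpa [hk, h1, h2, h3, show ¬ k < i + 2 by omega, hU] using this
    · rw [List.getElem?_eq_none (by simp at hl ⊢; omega), List.getElem?_eq_none (by simp; omega)]

theorem List.exists_eq_append_pair {Y : Type} {n i : ℕ} (hi : i + 1 < n) (x : Fin n → Y) :
    ∃ (U V : List Y) (a b : Y), U.length = i ∧ V.length = n - 2 - i ∧
      U ++ [a, b] ++ V = List.ofFn x := by
  refine ⟨(List.ofFn x).take i, (List.ofFn x).drop (i + 2), (List.ofFn x)[i]'(by simp; omega),
    (List.ofFn x)[i + 1]'(by simp; omega), by simp; omega, by simp; omega, ?_⟩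
  conv_rhs => rw [← List.take_append_drop i (List.ofFn x)]
  rw [List.drop_eq_getElem_cons (i := i) (by simp; omega),
    List.drop_eq_getElem_cons (i := i + 1) (by simp; omega)]
  simp

namespace TangleDiagram

variable {t} {n : ℕ}

theorem IsColoring.top_ofLetter {p : Fin (n - 1) × Bool} {c : (ofLetter p).Arc → X}
    (hc : IsColoring t (ofLetter p) c) {x : Fin n → X}
    (hx : (ofLetter p).bottomArcs.map c = List.ofFn x) :
    (ofLetter p).topArcs.map c = List.ofFn (letterAct R t p x) := by
  obtain ⟨i, b⟩ := p
  have hi := i.isLt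
  cases b
  · change (tensor (tensor (id _) xNeg) (id _)).Arc → X at c
    have h1 := (isColoring_tensor.mp (isColoring_tensor.mp hc).1).2
    replace hx := (map_bottomArcs_tensor c).symm.trans hx
    refine (map_topArcs_tensor c).trans ?_
    rw [map_bottomArcs_tensor] at hx
    rw [map_topArcs_tensor, topArcs_id, topArcs_id]
    obtain ⟨e1, e2, e3⟩ := List.eq_of_append_pair_eq_ofFn (i := i) (by omega)
      (by simp [length_bottomArcs, source]) hx
    refine (e3 _ _).trans (congrArg _ (funext fun k => ?_))
    replace h1 := isColoring_xNeg.mp h1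
    simp only [letterAct, Bool.false_eq_true, if_false, ← e1, ← e2]
    rw [← h1]
  · change (tensor (tensor (id _) xPos) (id _)).Arc → X at c
    have h1 := (isColoring_tensor.mp (isColoring_tensor.mp hc).1).2
    replace hx := (map_bottomArcs_tensor c).symm.trans hx
    refine (map_topArcs_tensor c).trans ?_
    rw [map_bottomArcs_tensor] at hx
    rw [map_topArcs_tensor, topArcs_id, topArcs_id]
    obtain ⟨e1, e2, e3⟩ := List.eq_of_append_pair_eq_ofFn (i := i) (by omega)
      (by simp [length_bottomArcs, source]) hx
    refine (e3 _ _).trans (congrArg _ (funext fun k => ?_))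
    replace h1 := isColoring_xPos.mp h1
    simp only [letterAct, if_true, ← e1, ← e2]
    rw [← h1]

theorem exists_coloring_crossing (t : Rˣ) (s : Bool) (a b : X) :
    ∃ c : (if s then xPos else xNeg).Arc → X, IsColoring t _ c ∧ (bottomArcs _).map c = [a, b] := by
  cases s
  · exact ⟨fun (x : xNeg.Arc) => match x with
      | .negOver => b
      | .negUnderIn => a
      | .negUnderOut => ((t⁻¹ : Rˣ) : R) • a + (1 - ((t⁻¹ : Rˣ) : R)) • b,
      isColoring_xNeg.mpr rfl, rfl⟩
  · exact ⟨fun (x : xPos.Arc) => match x with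
      | .posOver => a
      | .posUnderIn => b
      | .posUnderOut => (1 - (t : R)) • a + (t : R) • b,
      isColoring_xPos.mpr rfl, rfl⟩

theorem exists_coloring_ofLetter (t : Rˣ) (p : Fin (n - 1) × Bool) (x : Fin n → X) :
    ∃ c : (ofLetter p).Arc → X, IsColoring t (ofLetter p) c ∧
      (ofLetter p).bottomArcs.map c = List.ofFn x := by
  obtain ⟨U, V, a, b, hU, hV, hx⟩ := List.exists_eq_append_pair (i := p.1) (by omega) x
  obtain ⟨c₁, h1⟩ := exists_id_coloring (List.replicate p.1 Strand.pos) U (by simp [hU])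
  obtain ⟨c₂, h2⟩ := exists_id_coloring (List.replicate (n - 2 - p.1) Strand.pos) V (by simp [hV])
  obtain ⟨c₃, h3, h4⟩ := exists_coloring_crossing t p.2 a b
  obtain ⟨d, h5, h6, h7⟩ := exists_tensor_coloring (isColoring_id (t := t) _ c₁) h3
  obtain ⟨e, h8, h9, h10⟩ := exists_tensor_coloring h5 (isColoring_id (t := t) _ c₂)
  refine ⟨e, h8, ?_⟩
  refine (map_bottomArcs_tensor _).trans ?_
  rw [map_bottomArcs_tensor, h9, h10, h6, h7, h1, h2, h4, hx]

theorem comp_ofWord_match (p : Fin (n - 1) × Bool) (w : List (Fin (n - 1) × Bool)) :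
    (ofWord w).target = (ofLetter p).source := by
  rw [(ofWord_spec w).2.2, (ofLetter_spec p).2.1]

theorem IsColoring.top_ofWord {w : List (Fin (n - 1) × Bool)} {c : (ofWord w).Arc → X}
    (hc : IsColoring t (ofWord w) c) {x : Fin n → X}
    (hx : (ofWord w).bottomArcs.map c = List.ofFn x) :
    (ofWord w).topArcs.map c = List.ofFn (wordAct R t w x) := by
  induction w with
  | nil => exact hx
  | cons p w ih =>
    obtain ⟨h1, h2, h3⟩ := (isColoring_comp (comp_ofWord_match p w)).mp hc
    replace hx := (map_bottomArcs_comp _).symm.trans hx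
    rw [ih h2 hx] at h3
    refine (map_topArcs_comp _).trans ?_
    exact h1.top_ofLetter h3.symm

theorem exists_coloring_ofWord (t : Rˣ) (w : List (Fin (n - 1) × Bool)) (x : Fin n → X) :
    ∃ c : (ofWord w).Arc → X, IsColoring t (ofWord w) c ∧
      (ofWord w).bottomArcs.map c = List.ofFn x := by
  induction w with
  | nil =>
    obtain ⟨c, hc⟩ := exists_id_coloring (List.replicate n Strand.pos) (List.ofFn x) (by simp)
    exact ⟨c, isColoring_id _ c, hc⟩
  | cons p w ih =>
    obtain ⟨c, h1, h2⟩ := ih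
    obtain ⟨c', h3, h4⟩ := exists_coloring_ofLetter t p (wordAct R t w x)
    obtain ⟨d, h5, -, h6⟩ := exists_comp_coloring (comp_ofWord_match p w) h3 h1 (by
      rw [h1.top_ofWord h2, h4])
    refine ⟨d, h5, ?_⟩
    refine (map_bottomArcs_comp _).trans ?_
    rw [h6, h2]

/-! ### Colorings of closed braids -/

/-- The diagram of the closure of a braid word. -/
abbrev closedBraid (n : ℕ) (w : List (Fin (n - 1) × Bool)) : TangleDiagram :=
  comp (ev n) (comp (tensor (ofWord w) (id (List.replicate n Strand.neg))) (coev n))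

/-- The arcs of the braid in the closed braid. -/
def braidArc (w : List (Fin (n - 1) × Bool)) (a : (ofWord w).Arc) : (closedBraid n w).Arc :=
  .lower (.upper (.left a))

theorem target_coev_eq (w : List (Fin (n - 1) × Bool)) : (coev n).target =
    (tensor (ofWord w) (id (List.replicate n Strand.neg))).source := by
  simp [source, coev_spec, ofWord_spec]

theorem target_braid_eq (w : List (Fin (n - 1) × Bool)) :
    (comp (tensor (ofWord w) (id (List.replicate n Strand.neg))) (coev n)).target =
      (ev n).source := by
  simp [target, ev_spec, ofWord_spec]

theorem length_bottomArcs_ofWord (w : List (Fin (n - 1) × Bool)) :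
    (ofWord w).bottomArcs.length = n := by
  rw [length_bottomArcs, (ofWord_spec w).2.1, List.length_replicate]

theorem length_topArcs_ofWord (w : List (Fin (n - 1) × Bool)) :
    (ofWord w).topArcs.length = n := by
  rw [length_topArcs, (ofWord_spec w).2.2, List.length_replicate]

/-- In a closed braid the colors along the descending strands mirror those along the bottom of
the braid, and the braid fixes the latter. -/
theorem IsColoring.closedBraid_boundary {w : List (Fin (n - 1) × Bool)}
    {c : (closedBraid n w).Arc → X} (hc : IsColoring t (closedBraid n w) c) :
    (coev n).topArcs.map (c ∘ fun a => .lower (.lower a)) =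
      (ofWord w).bottomArcs.map (c ∘ braidArc w) ++
        ((ofWord w).bottomArcs.map (c ∘ braidArc w)).reverse ∧
    (ofWord w).topArcs.map (c ∘ braidArc w) = (ofWord w).bottomArcs.map (c ∘ braidArc w) := by
  obtain ⟨h1, h2, h3⟩ := (isColoring_comp (target_braid_eq w)).mp hc
  obtain ⟨h4, h5, h6⟩ := (isColoring_comp (target_coev_eq w)).mp h2
  obtain ⟨l, hl, e1⟩ := h5.exists_top_coev
  obtain ⟨l', hl', e2⟩ := h1.exists_bottom_ev
  rw [e1, map_bottomArcs_tensor] at h6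
  rw [e2, map_topArcs_comp, map_topArcs_tensor] at h3
  obtain ⟨e3, e4⟩ := List.append_inj h6 (by
    rw [hl, List.length_map, length_bottomArcs_ofWord])
  obtain ⟨e5, e6⟩ := List.append_inj h3 (by
    rw [hl', List.length_map, length_topArcs_ofWord])
  -- The descending strands carry the reversed cup colors to the reversed cap colors, which forces
  -- `l = l'`.
  rw [topArcs_id, ← e4] at e6
  have e7 := List.reverse_injective e6
  constructor
  · exact e1.trans (by rw [e3]; rfl)
  · exact e5.trans (e7.symm.trans e3)

/-- The colors at the bottom of the braid fix those on top of the cups, hence the cups, then the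
braid with its descending strands, then the caps. -/
theorem IsColoring.closedBraid_ext {w : List (Fin (n - 1) × Bool)}
    {c c' : (closedBraid n w).Arc → X} (hc : IsColoring t (closedBraid n w) c)
    (hc' : IsColoring t (closedBraid n w) c')
    (h : (ofWord w).bottomArcs.map (c ∘ braidArc w) =
      (ofWord w).bottomArcs.map (c' ∘ braidArc w)) : c = c' := by
  have ha := hc.closedBraid_boundary.1
  have ha' := hc'.closedBraid_boundary.1
  obtain ⟨h1, h2, h3⟩ := (isColoring_comp (target_braid_eq w)).mp hc
  obtain ⟨h4, h5, h6⟩ := (isColoring_comp (target_coev_eq w)).mp h2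
  obtain ⟨h1', h2', h3'⟩ := (isColoring_comp (target_braid_eq w)).mp hc'
  obtain ⟨h4', h5', h6'⟩ := (isColoring_comp (target_coev_eq w)).mp h2'
  have e1 := topDetermined_coev n _ _ h5 h5' (by
    refine ha.trans (Eq.trans ?_ ha'.symm)
    rw [h])
  have e2 := ((bottomDetermined_ofWord w).tensor (bottomDetermined_id _)) _ _ h4 h4' (by
    rw [← h6, ← h6', e1])
  have e3 := bottomDetermined_ev n _ _ h1 h1' (by
    rw [← h3, ← h3', map_topArcs_comp, map_topArcs_comp, e2])
  funext a
  cases a with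
  | upper a => exact congrFun e3 a
  | lower a =>
    cases a with
    | upper a => exact congrFun e2 a
    | lower a => exact congrFun e1 a

theorem IsColoring.wordAct_eq {w : List (Fin (n - 1) × Bool)}
    {c : (closedBraid n w).Arc → X} (hc : IsColoring t (closedBraid n w) c) {x : Fin n → X}
    (hx : (ofWord w).bottomArcs.map (c ∘ braidArc w) = List.ofFn x) :
    wordAct R t w x = x := by
  obtain ⟨-, h2, -⟩ := (isColoring_comp (target_braid_eq w)).mp hc
  obtain ⟨h4, -, -⟩ := (isColoring_comp (target_coev_eq w)).mp h2
  have h := hc.closedBraid_boundary.2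
  have h' := (isColoring_tensor.mp h4).1.top_ofWord hx
  exact List.ofFn_injective (h'.symm.trans (h.trans hx))

/-- The pieces are colored separately and glued; the only obstruction is that the braid must return
`x` at its top. -/
theorem exists_coloring_closedBraid {w : List (Fin (n - 1) × Bool)} {x : Fin n → X}
    (hx : wordAct R t w x = x) : ∃ c : (closedBraid n w).Arc → X,
      IsColoring t (closedBraid n w) c ∧
      (ofWord w).bottomArcs.map (c ∘ braidArc w) = List.ofFn x := by
  obtain ⟨c₁, h1, h2⟩ := exists_coloring_coev (t := t) (n := n) (List.ofFn x) (by simp)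
  obtain ⟨c₂, h3, h4⟩ := exists_coloring_ofWord t w x
  obtain ⟨c₃, h5⟩ := exists_id_coloring (List.replicate n Strand.neg) (List.ofFn x).reverse
    (by simp)
  obtain ⟨c₄, h6, h7⟩ := exists_coloring_ev (t := t) (n := n) (List.ofFn x) (by simp)
  obtain ⟨d, k1, k2, k3⟩ := exists_tensor_coloring h3 (isColoring_id _ c₃)
  obtain ⟨e, k4, k5, -⟩ := exists_comp_coloring (target_coev_eq w) k1 h1 (by
    rw [map_bottomArcs_tensor, k2, k3, h2, h4, h5])
  obtain ⟨f, k6, -, k7⟩ := exists_comp_coloring (target_braid_eq w) h6 k4 (by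
    rw [map_topArcs_comp, k5, map_topArcs_tensor, k2, k3, h7, topArcs_id, h5,
      h3.top_ofWord h4, hx])
  refine ⟨f, k6, ?_⟩
  rw [← h4]
  congr 1
  rw [← k2, ← k5, ← k7]
  rfl

theorem exists_ofFn_eq_bottom {Y : Type} (w : List (Fin (n - 1) × Bool))
    (c : (ofWord w).Arc → Y) : ∃ x : Fin n → Y, (ofWord w).bottomArcs.map c = List.ofFn x := by
  have h : ((ofWord w).bottomArcs.map c).length = n := by
    rw [List.length_map, length_bottomArcs_ofWord]
  refine ⟨fun k => ((ofWord w).bottomArcs.map c)[(k : ℕ)], ?_⟩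
  apply List.ext_getElem
  · simp [h]
  · simp

instance (T : TangleDiagram) : Finite T.Arc := by
  induction T with
  | id ε =>
    exact Finite.of_surjective (fun i : Fin ε.length => Arc.strand ε i)
      fun a => by cases a; exact ⟨_, rfl⟩
  | xPos =>
    exact Finite.of_surjective (![.posOver, .posUnderIn, .posUnderOut] : Fin 3 → xPos.Arc)
      fun a => by cases a; exacts [⟨0, rfl⟩, ⟨1, rfl⟩, ⟨2, rfl⟩]
  | xNeg =>
    exact Finite.of_surjective (![.negOver, .negUnderIn, .negUnderOut] : Fin 3 → xNeg.Arc)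
      fun a => by cases a; exacts [⟨0, rfl⟩, ⟨1, rfl⟩, ⟨2, rfl⟩]
  | capPosNeg => exact Finite.of_surjective (fun _ : Unit => Arc.capPN) fun a => by cases a; simp
  | capNegPos => exact Finite.of_surjective (fun _ : Unit => Arc.capNP) fun a => by cases a; simp
  | cupPosNeg => exact Finite.of_surjective (fun _ : Unit => Arc.cupPN) fun a => by cases a; simp
  | cupNegPos => exact Finite.of_surjective (fun _ : Unit => Arc.cupNP) fun a => by cases a; simp
  | comp T' T h' h =>
    exact Finite.of_surjective (Sum.elim Arc.upper Arc.lower : T'.Arc ⊕ T.Arc → (comp T' T).Arc)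
      fun a => by
        cases a with
        | upper a => exact ⟨.inl a, rfl⟩
        | lower a => exact ⟨.inr a, rfl⟩
  | tensor T T' h h' =>
    exact Finite.of_surjective (Sum.elim Arc.left Arc.right : T.Arc ⊕ T'.Arc → (tensor T T').Arc)
      fun a => by
        cases a with
        | left a => exact ⟨.inl a, rfl⟩
        | right a => exact ⟨.inr a, rfl⟩

end TangleDiagram

end Coloring

/-! ## The Burau matrix acting on colors -/

section BurauAction

variable {R X : Type} [CommRing R] [AddCommGroup X] [Module R X] (t : Rˣ) {n : ℕ}

theorem burau_cons (p : Fin (n - 1) × Bool) (w : List (Fin (n - 1) × Bool)) (v : Fin n → R) :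
    burau t (braidOfWord n (p :: w)) v = letterAct R t p (burau t (braidOfWord n w) v) := by
  have h : braidOfWord n (p :: w) = braidOfWord n [p] * braidOfWord n w := by
    rw [braidOfWord, braidOfWord, braidOfWord, ← map_mul, FreeGroup.mul_mk]
    rfl
  have hl : ∀ u : Fin n → R, burau t (braidOfWord n [p]) u = letterAct R t p u := by
    intro u
    obtain ⟨i, b⟩ := p
    cases b
    · have h1 : FreeGroup.mk [(i, false)] = (FreeGroup.of i)⁻¹ := by
        simp [FreeGroup.of, FreeGroup.inv_mk, FreeGroup.invRev]
      have h2 : burau (R := R) t (braidOfWord n [(i, false)]) = (burauGen t i)⁻¹ := by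
        rw [braidOfWord, h1, map_inv, map_inv]
        exact congrArg _ (PresentedGroup.toGroup.of _)
      rw [h2]
      rfl
    · have h2 : burau (R := R) t (braidOfWord n [(i, true)]) = burauGen t i :=
        PresentedGroup.toGroup.of _
      rw [h2]
      rfl
  rw [h, map_mul, LinearEquiv.mul_apply, hl]

theorem burau_apply (w : List (Fin (n - 1) × Bool)) (v : Fin n → R) :
    burau t (braidOfWord n w) v = wordAct R t w v := by
  induction w with
  | nil =>
    have : braidOfWord n [] = 1 := by
      rw [braidOfWord, ← FreeGroup.one_eq_mk, map_one]
    rw [this, map_one]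
    rfl
  | cons p w ih => rw [burau_cons, ih]; rfl

theorem burauMatrix_apply (B : BraidGroup n) (i j : Fin n) :
    burauMatrix t B i j = burau t B (Pi.single j 1) i := by
  rw [burauMatrix, LinearMap.toMatrix'_apply]
  rfl

/-- The action on colors is natural in linear maps, here the map Rⁿ → X sending the j-th basis
vector to `x j`. Hence its matrix, computed on Rⁿ, describes it on every module. -/
theorem sum_smul_letterAct (p : Fin (n - 1) × Bool) (v : Fin n → Fin n → R) (x : Fin n → X)
    (k : Fin n) : ∑ j, letterAct R t p (v j) k • x j =
      letterAct R t p (fun l => ∑ j, v j l • x j) k := by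
  simp only [letterAct]
  split_ifs <;>
    simp only [smul_eq_mul, add_smul, mul_smul, Finset.sum_add_distrib, Finset.smul_sum]

theorem wordAct_eq_sum (w : List (Fin (n - 1) × Bool)) (x : Fin n → X) (k : Fin n) :
    wordAct R t w x k = ∑ j, burauMatrix t (braidOfWord n w) k j • x j := by
  simp only [burauMatrix_apply, burau_apply]
  induction w generalizing k with
  | nil => simp [wordAct, Pi.single_apply]
  | cons p w ih =>
    change letterAct R t p (wordAct R t w x) k =
      ∑ j, letterAct R t p (wordAct R t w (Pi.single j 1)) k • x j
    rw [sum_smul_letterAct, funext ih]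

theorem sum_one_sub_burauMatrix_smul (w : List (Fin (n - 1) × Bool)) (x : Fin n → X)
    (k : Fin n) :
    ∑ j, (1 - burauMatrix t (braidOfWord n w)) k j • x j = x k - wordAct R t w x k := by
  simp [wordAct_eq_sum, sub_smul, Finset.sum_sub_distrib, Matrix.one_apply]

/-- The constant coloring is always allowed; this gives the right null vector of Id - Burau. -/
theorem letterAct_const (p : Fin (n - 1) × Bool) :
    letterAct R t p (fun _ => (1 : R)) = fun _ => 1 := by
  funext k
  simp [letterAct]

/-- From tⁱ((1 - t)a + tb) + tⁱ⁺¹a = tⁱa + tⁱ⁺¹b, and likewise for the inverse letter: this gives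
the left null vector (1, t, …, tⁿ⁻¹) of Id - Burau. -/
theorem sum_pow_mul_letterAct (p : Fin (n - 1) × Bool) (v : Fin n → R) :
    ∑ k : Fin n, (t : R) ^ (k : ℕ) * letterAct R t p v k = ∑ k : Fin n, (t : R) ^ (k : ℕ) * v k := by
  obtain ⟨i, b⟩ := p
  have hi := i.isLt
  have ht : (t : R) * ((t⁻¹ : Rˣ) : R) = 1 := t.mul_inv
  rw [← sub_eq_zero, ← Finset.sum_sub_distrib,
    Fintype.sum_eq_add (⟨i, by omega⟩ : Fin n) ⟨i + 1, by omega⟩ (by simp [Fin.ext_iff])]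
  · cases b
    · simp [letterAct]
      linear_combination (t : R) ^ (i : ℕ) * (v ⟨i, by omega⟩ - v ⟨i + 1, by omega⟩) * ht
    · simp [letterAct]
      ring
  · rintro k ⟨h1, h2⟩
    rw [Ne, Fin.ext_iff] at h1 h2
    simp only at h1 h2
    simp [letterAct, h1, h2]

theorem wordAct_const (w : List (Fin (n - 1) × Bool)) :
    wordAct R t w (fun _ => (1 : R)) = fun _ => 1 := by
  induction w with
  | nil => rfl
  | cons p w ih => exact (congrArg _ ih).trans (letterAct_const t p)

theorem sum_pow_mul_wordAct (w : List (Fin (n - 1) × Bool)) (v : Fin n → R) :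
    ∑ k : Fin n, (t : R) ^ (k : ℕ) * wordAct R t w v k = ∑ k : Fin n, (t : R) ^ (k : ℕ) * v k := by
  induction w with
  | nil => rfl
  | cons p w ih => exact (sum_pow_mul_letterAct t p _).trans ih

end BurauAction

/-! ## Minors of a matrix with dependent rows and columns -/

section Minors

variable {R : Type} [CommRing R] {m : ℕ}

/-- If the columns of `M` add up to zero and the rows satisfy a linear relation in which the first
row has coefficient one, then the minors of `M` are multiples of the principal one. -/
theorem Matrix.minorIdeal_eq_span_removeFirst (M : Matrix (Fin (m + 1)) (Fin (m + 1)) R)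
    (a : Fin (m + 1) → R) (ha : a 0 = 1) (hrow : ∀ j, ∑ i, a i * M i j = 0)
    (hcol : ∀ i, ∑ j, M i j = 0) :
    minorIdeal (Set.range fun i => M i) m = Ideal.span {M.removeFirst.det} := by
  -- `E` rebuilds the first row and `F` the first column from the others, so M = E M₀ F and every
  -- minor of size `m` is a product of three determinants, one of them det M₀.
  let E : Matrix (Fin (m + 1)) (Fin m) R :=
    Matrix.of (Fin.cons (fun k => -a k.succ) fun i k => if i = k then 1 else 0)
  let F : Matrix (Fin m) (Fin (m + 1)) R :=
    Matrix.of fun k => Fin.cons (-1) fun j => if k = j then 1 else 0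
  have hr : ∀ j, M 0 j = ∑ i : Fin m, -a i.succ * M i.succ j := by
    intro j
    have := hrow j
    rw [Fin.sum_univ_succ, ha, one_mul] at this
    rw [eq_neg_of_add_eq_zero_left this, ← Finset.sum_neg_distrib]
    simp
  have hc : ∀ i, M i 0 = ∑ j : Fin m, M i j.succ * -1 := by
    intro i
    have := hcol i
    rw [Fin.sum_univ_succ] at this
    rw [eq_neg_of_add_eq_zero_left this, ← Finset.sum_neg_distrib]
    simp
  have hE : M.submatrix id Fin.succ = E * M.removeFirst := by
    ext i j
    refine Fin.cases ?_ (fun i => ?_) i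
    · simp [E, Matrix.mul_apply, Matrix.removeFirst, hr]
    · simp [E, Matrix.mul_apply, Matrix.removeFirst]
  have hF : M = M.submatrix id Fin.succ * F := by
    ext i j
    refine Fin.cases ?_ (fun j => ?_) j
    · simp [F, Matrix.mul_apply, hc]
    · simp [F, Matrix.mul_apply]
  apply le_antisymm
  · refine minorIdeal_le_iff.mpr fun v c hv => ?_
    choose r hr' using hv
    have h : (Matrix.of fun i j => v i (c j)) =
        E.submatrix r id * M.removeFirst * F.submatrix id c := by
      have h1 : (Matrix.of fun i j => v i (c j)) = M.submatrix r c := by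
        ext i j
        simp [← hr']
      rw [h1]
      conv_lhs => rw [hF, hE]
      ext i j
      simp [Matrix.mul_apply]
    rw [h, Matrix.det_mul, Matrix.det_mul, Ideal.mem_span_singleton]
    exact ⟨(E.submatrix r id).det * (F.submatrix id c).det, by ring⟩
  · rw [Ideal.span_singleton_le_iff_mem]
    exact det_mem_minorIdeal (fun i => M i.succ) Fin.succ fun i => ⟨i.succ, rfl⟩

end Minors

/-! ## The Alexander module of a closed braid -/

section ClosedBraid

open TangleDiagram

/-- The scalar by which an element of the group of a diagram acts. -/
abbrev meridianScalar (T : TangleDiagram) : T.WirtingerGroup →* ℤ[T;T⁻¹] :=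
  (AddMonoidAlgebra.of ℤ ℤ).comp T.meridianHom

theorem meridianHom_of (T : TangleDiagram) (a : T.Arc) :
    T.meridianHom (.of a) = Multiplicative.ofAdd 1 :=
  PresentedGroup.toGroup.of _

theorem meridianScalar_comp_mk (T : TangleDiagram) :
    (meridianScalar T).comp (PresentedGroup.mk _) = freeDegree laurentT T.Arc := by
  refine FreeGroup.ext_hom _ _ fun a => ?_
  rw [freeDegree_of]
  change AddMonoidAlgebra.of ℤ ℤ (T.meridianHom (.of a)) = _
  rw [meridianHom_of]
  rfl

variable {X : Type} [AddCommGroup X] [Module ℤ[T;T⁻¹] X]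

/-- With `TangleDiagram.IsColoring.exists_isCrossedHom`, this identifies crossed homomorphisms on
the link group with colorings by their values on meridians. -/
theorem IsCrossedHom.isColoring {T : TangleDiagram} {δ : T.WirtingerGroup → X}
    (hδ : IsCrossedHom (meridianScalar T) δ) :
    IsColoring laurentT T fun a => δ (.of a) := by
  have h := hδ.comp_hom (PresentedGroup.mk _)
  rw [meridianScalar_comp_mk] at h
  have h' := h.freeGroup_ext (isCrossedHom_freeCrossedHom _ fun a => δ (.of a)) fun a => by
    rw [freeCrossedHom_of]; rfl
  intro r hr
  rw [← h', Function.comp_apply, PresentedGroup.one_of_mem hr, hδ.map_one]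

theorem TangleDiagram.IsColoring.exists_isCrossedHom {T : TangleDiagram} {c : T.Arc → X}
    (hc : IsColoring laurentT T c) :
    ∃ δ : T.WirtingerGroup → X, IsCrossedHom (meridianScalar T) δ ∧ ∀ a, δ (.of a) = c a :=
  exists_isCrossedHom_presentedGroup (meridianScalar T) c fun r hr => by
    rw [meridianScalar_comp_mk]
    exact hc r hr

theorem meridianHom_ne_one {T : TangleDiagram} (a : T.Arc) : T.meridianHom ≠ 1 := by
  intro h
  have := meridianHom_of T a
  rw [h] at this
  exact absurd (congrArg Multiplicative.toAdd this) (by simp)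

variable {m : ℕ} (w : List (Fin (m + 1 - 1) × Bool))

/-- The quotient of Λᵐ⁺¹ by the rows of `M` is shown to be the Alexander module, generated by the
basis classes `q`. -/
theorem firstElementaryIdeal_closedBraid
    (P : FinitePresentation (closedBraid (m + 1) w).WirtingerGroup) :
    P.firstElementaryIdeal (closedBraid (m + 1) w).meridianHom =
      Ideal.span {(1 - burauMatrix laurentT (braidOfWord (m + 1) w)).removeFirst.det} := by
  set M := 1 - burauMatrix laurentT (braidOfWord (m + 1) w) with hM
  set S := Submodule.span ℤ[T;T⁻¹] (Set.range fun i => M i) with hS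
  set q : Fin (m + 1) → (Fin (m + 1) → ℤ[T;T⁻¹]) ⧸ S := fun j => S.mkQ (Pi.single j 1) with hq
  have hsum : ∀ v : Fin (m + 1) → ℤ[T;T⁻¹], ∑ j, v j • q j = S.mkQ v := by
    intro v
    simp_rw [hq, ← map_smul, ← map_sum]
    congr 1
    ext k
    simp [Finset.sum_apply, Pi.single_apply]
  -- The rows of `M` vanish in the quotient, which says exactly that `q` is fixed by the braid and
  -- so extends to a coloring of the closure.
  have hfix : wordAct ℤ[T;T⁻¹] laurentT w q = q := by
    funext k
    have h := sum_one_sub_burauMatrix_smul laurentT w q k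
    rw [hsum, Submodule.mkQ_apply,
      (Submodule.Quotient.mk_eq_zero S).mpr (Submodule.subset_span ⟨k, rfl⟩)] at h
    exact (sub_eq_zero.mp h.symm).symm
  have hqspan : Submodule.span ℤ[T;T⁻¹] (Set.range q) = ⊤ := by
    rw [eq_top_iff]
    rintro z -
    obtain ⟨v, rfl⟩ := S.mkQ_surjective z
    rw [← hsum]
    exact Submodule.sum_mem _ fun j _ => Submodule.smul_mem _ _ (Submodule.subset_span ⟨j, rfl⟩)
  obtain ⟨c, hc, hcq⟩ := exists_coloring_closedBraid hfix
  obtain ⟨δ, hδ, hδc⟩ := hc.exists_isCrossedHom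
  have hqδ : ∀ j, ∃ a : (closedBraid (m + 1) w).Arc, q j = δ (.of a) := by
    intro j
    have : q j ∈ (ofWord w).bottomArcs.map (c ∘ braidArc w) := by
      rw [hcq]; exact (List.mem_ofFn' _ _).mpr ⟨j, rfl⟩
    obtain ⟨a, -, ha⟩ := List.mem_map.mp this
    exact ⟨braidArc w a, by rw [hδc, ← ha]; rfl⟩
  have hδspan : Submodule.span ℤ[T;T⁻¹] (Set.range δ) = ⊤ := by
    rw [eq_top_iff, ← hqspan]
    refine Submodule.span_mono ?_
    rintro _ ⟨j, rfl⟩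
    obtain ⟨a, ha⟩ := hqδ j
    exact ⟨_, ha.symm⟩
  -- Any `δ'` gives a fixed vector `x` at the bottom of the braid, so `q j ↦ x j` respects the rows
  -- of `M`. The two resulting colorings agree there, hence everywhere.
  have huniv : IsUniversalCrossedHom (meridianScalar _) δ := by
    refine ⟨hδ, fun Y _ _ δ' hδ' => ?_⟩
    obtain ⟨x, hx⟩ := exists_ofFn_eq_bottom w ((fun a => δ' (.of a)) ∘ braidArc w)
    have hxfix := hδ'.isColoring.wordAct_eq hx
    let f := S.liftQ (Fintype.linearCombination ℤ[T;T⁻¹] x) (by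
      rw [hS, Submodule.span_le]
      rintro _ ⟨k, rfl⟩
      rw [SetLike.mem_coe, LinearMap.mem_ker, Fintype.linearCombination_apply]
      have h := sum_one_sub_burauMatrix_smul laurentT w x k
      rw [hxfix, sub_self] at h
      exact h)
    have hf : ∀ j, f (q j) = x j := by
      intro j
      simp [f, hq, Fintype.linearCombination_apply, Pi.single_apply]
    refine ⟨f, fun g => congrFun ((hδ.comp_linear f).presentedGroup_ext hδ' fun a => ?_) g⟩
    refine congrFun ((hδ.comp_linear f).isColoring.closedBraid_ext hδ'.isColoring ?_) a
    rw [hx]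
    have : ((fun a => (f ∘ δ) (.of a)) ∘ braidArc w) = f ∘ (c ∘ braidArc w) := by
      funext a
      simp [hδc]
    rw [this, ← List.map_map, hcq, List.map_ofFn]
    congr 1
    exact funext hf
  -- Some arc exists, so the meridian homomorphism is nontrivial and no presentation has zero
  -- generators.
  obtain ⟨a, -⟩ := hqδ 0
  rw [P.firstElementaryIdeal_eq _ q huniv hδspan hqspan (P.numGens_ne_zero _ (meridianHom_ne_one a))]
  have hrel : relationsOn (R := ℤ[T;T⁻¹]) q Set.univ = S := by
    ext v
    rw [mem_relationsOn, hsum, Submodule.mkQ_apply, Submodule.Quotient.mk_eq_zero]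
    simp
  rw [hrel, hS, minorIdeal_span]
  refine M.minorIdeal_eq_span_removeFirst (fun k => (laurentT : ℤ[T;T⁻¹]) ^ (k : ℕ)) (by simp)
    (fun j => ?_) fun i => ?_
  · have h := sum_pow_mul_wordAct laurentT w (Pi.single j (1 : ℤ[T;T⁻¹]))
    simp only [← burau_apply, ← burauMatrix_apply] at h
    simp only [hM, Matrix.sub_apply, mul_sub, Finset.sum_sub_distrib, h]
    simp [Matrix.one_apply, Pi.single_apply]
  · have h := sum_one_sub_burauMatrix_smul laurentT w (fun _ => (1 : ℤ[T;T⁻¹])) i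
    simpa only [wordAct_const, smul_eq_mul, mul_one, sub_self] using h

end ClosedBraid

/-! ## Evaluation at complex numbers -/

section Evaluation

variable {R R' : Type} [CommRing R] [CommRing R'] {n : ℕ}

/-- Base change: it makes the Burau matrix at a complex number the specialization of the one over Λ.
-/
theorem map_wordAct (f : R →+* R') (t : Rˣ) (w : List (Fin (n - 1) × Bool)) (v : Fin n → R)
    (k : Fin n) :
    f (wordAct R t w v k) = wordAct R' (Units.map f t) w (fun l => f (v l)) k := by
  induction w generalizing k with
  | nil => rfl
  | cons p w ih =>
    change f (letterAct R t p (wordAct R t w v) k) =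
      letterAct R' (Units.map f t) p (wordAct R' (Units.map f t) w fun l => f (v l)) k
    rw [← funext ih]
    simp only [letterAct]
    split_ifs <;> simp [← map_inv]

theorem map_burauMatrix (f : R →+* R') (t : Rˣ) (w : List (Fin (n - 1) × Bool)) :
    (burauMatrix t (braidOfWord n w)).map f = burauMatrix (Units.map f t) (braidOfWord n w) := by
  ext i j
  rw [Matrix.map_apply, burauMatrix_apply, burauMatrix_apply, burau_apply, burau_apply, map_wordAct]
  congr 1
  funext l
  simp [Pi.single_apply, apply_ite f]

theorem map_det_removeFirst {m : ℕ} (f : R →+* R') (t : Rˣ)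
    (w : List (Fin (m + 1 - 1) × Bool)) :
    f (1 - burauMatrix t (braidOfWord (m + 1) w)).removeFirst.det =
      (1 - burauMatrix (Units.map (f : R →* R') t) (braidOfWord (m + 1) w)).removeFirst.det := by
  rw [RingHom.map_det, ← map_burauMatrix]
  congr 1
  ext i j
  simp [Matrix.removeFirst, Matrix.one_apply, apply_ite f]

theorem evalComplex_det_removeFirst {m : ℕ} (t : ℂˣ) (w : List (Fin (m + 1 - 1) × Bool)) :
    evalComplex t (1 - burauMatrix laurentT (braidOfWord (m + 1) w)).removeFirst.det =
      (1 - burauMatrix t (braidOfWord (m + 1) w)).removeFirst.det := by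
  have h := map_det_removeFirst (LaurentPolynomial.eval₂ (Int.castRingHom ℂ) t) laurentT w
  have ht : Units.map (LaurentPolynomial.eval₂ (Int.castRingHom ℂ) t : ℤ[T;T⁻¹] →* ℂ) laurentT =
      t := by
    ext
    change LaurentPolynomial.eval₂ (Int.castRingHom ℂ) t (LaurentPolynomial.T 1) = t
    rw [LaurentPolynomial.eval₂_T, zpow_one]
  rw [ht] at h
  exact h

end Evaluation

/-- For a braid `B` on `m + 1 ≥ 1` strands, represented by the word `w`: the determinant of
`(Id - Burau(B))₀` over `ℤ[t, t⁻¹]` is an Alexander polynomial of the closure of `B`, and each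
Alexander polynomial of the closure agrees, up to a factor `± tᵏ`, with the determinant of
`(Id - Burau_t(B))₀` for every nonzero complex `t`. -/
theorem mainTheorem10 (m : ℕ) (B : BraidGroup (m + 1)) (w : List (Fin (m + 1 - 1) × Bool))
    (hw : braidOfWord (m + 1) w = B) :
    (braidClosure (m + 1) w).IsAlexanderPolynomial (1 - burauMatrix laurentT B).removeFirst.det ∧
    ∀ Δ : ℤ[T;T⁻¹], (braidClosure (m + 1) w).IsAlexanderPolynomial Δ →
      ∃ (u : ℤˣ) (k : ℤ), ∀ t : ℂˣ,
        evalComplex t Δ =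
          ((u : ℤ) : ℂ) * (t : ℂ) ^ k * (1 - burauMatrix t B).removeFirst.det := by
  subst hw
  have hpres : Nonempty (FinitePresentation (braidClosure (m + 1) w).toTangle.WirtingerGroup) :=
    nonempty_finitePresentation _
  have hgcd : ∀ (P : FinitePresentation (braidClosure (m + 1) w).toTangle.WirtingerGroup)
      (d : ℤ[T;T⁻¹]),
      d ∣ (1 - burauMatrix laurentT (braidOfWord (m + 1) w)).removeFirst.det ↔
        ∀ x ∈ P.firstElementaryIdeal (braidClosure (m + 1) w).toTangle.meridianHom, d ∣ x := by
    intro P d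
    have hP : P.firstElementaryIdeal (braidClosure (m + 1) w).toTangle.meridianHom = _ :=
      firstElementaryIdeal_closedBraid w P
    rw [hP]
    constructor
    · intro h x hx
      exact h.trans (Ideal.mem_span_singleton.mp hx)
    · exact fun h => h _ (Ideal.mem_span_singleton_self _)
  refine ⟨⟨hpres, hgcd⟩, fun Δ hΔ => ?_⟩
  obtain ⟨P⟩ := hpres
  -- Two greatest common divisors of the same ideal divide each other, hence differ by a unit.
  have h1 := (hgcd P Δ).mpr ((hΔ.2 P Δ).mp dvd_rfl)
  have h2 := (hΔ.2 P _).mpr ((hgcd P _).mp dvd_rfl)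
  obtain ⟨v, hv⟩ := associated_of_dvd_dvd h2 h1
  obtain ⟨u, k, huk⟩ := LaurentPolynomial.exists_eq_of_isUnit v.isUnit
  refine ⟨u, k, fun t => ?_⟩
  rw [← evalComplex_det_removeFirst, ← hv, huk, evalComplex, evalComplex, map_mul,
    LaurentPolynomial.eval₂_C_mul_T, mul_comm]
  simp

end
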